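/- Let $\Gamma$ be an additive abelian group. For a $\Gamma$-graded ring $B=\bigoplus_{\gamma\in\Gamma}B_\gamma$, not necessarily unital but with local units of degree $0$ (every finite subset of $B$ lies in $fBf$ for some idempotent $f\in B_0$), let $\mathcal V^{\mathrm{gr}}(B)$ be the commutative monoid, under direct sum, of graded isomorphism classes of graded finitely generated projective right $B$-modules $P$ with $PB=P$ (finite generation and projectivity are understood over the unitization $\mathbb Z\oplus B$), and let $K_0^{\mathrm{gr}}(B)$ be its group completion. It is a $\mathbb Z[\Gamma]$-module through $\gamma\cdot[P]=[P(\gamma)]$, where $P(\gamma)_\mu=P_{\gamma+\mu}$, and it is preordered by $x\le y$ if and only if $y-x=[P]$ for some $[P]\in\mathcal V^{\mathrm{gr}}(B)$. For a $\Gamma$-graded ring $A$ and $\overline\delta=(\delta_1,\delta_2,\dots)\in\prod_{i\ge1}\Gamma$, let $M_\infty(A)(\overline\delta)$ be the ring of $\mathbb N\times\mathbb N$ matrices over $A$ with only finitely many nonzero entries, graded by $(a_{i,j})\in M_\infty(A)(\overline\delta)_\lambda$ if and only if $a_{i,j}\in A_{\lambda+\delta_j-\delta_i}$ for all $i,j$.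 (1) Let $A$ be a $\Gamma$-graded ring, not necessarily unital, with a sequence of idempotents $e_1,e_2,\dots\in A_0$ such that $e_ne_{n+1}=e_n$ for all $n$ and $\bigcup_n e_nAe_n=A$. Then for every $\overline\delta\in\prod_{i\ge 1}\Gamma$ the embedding $\iota\colon A\to M_\infty(A)(\overline\delta)$ into the $(1,1)$ corner induces an isomorphism of $\mathbb Z[\Gamma]$-modules $$K_0^{\mathrm{gr}}(\iota)\colon K_0^{\mathrm{gr}}(A)\to K_0^{\mathrm{gr}}\big(M_\infty(A)(\overline\delta)\big),\qquad [P]\mapsto [P\otimes_A M_\infty(A)(\overline\delta)],$$ which is an order isomorphism: $x\le y$ if and only if $K_0^{\mathrm{gr}}(\iota)(x)\le K_0^{\mathrm{gr}}(\iota)(y)$. Here $M_\infty(A)(\overline\delta)$ is a left $A$-module through $\iota$, and the tensor product is formed over the unitizations, $P\otimes_{\mathbb Z\oplus A}(\mathbb Z\oplus M_\infty(A)(\overline\delta))$, with the grading $\deg(p\otimes b)=\deg p+\deg b$. (2) In particular, let $K$ be a field, let $E=(E^0,E^1,r,s)$ be a directed graph with $E^0$ and $E^1$ countable, and let $\overline\delta\in\prod_{i\ge1}\mathbb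 Z$. Let $L_K(E)$ be the Leavitt path algebra, that is, the $K$-algebra generated by $v$ ($v\in E^0$), $e$ and $e^*$ ($e\in E^1$) subject to $vv=v$ and $vw=0$ for $v\ne w$; $s(e)e=e=e\,r(e)$; $r(e)e^*=e^*=e^*s(e)$; $e^*e=r(e)$ and $e^*f=0$ for $e\ne f$; and $v=\sum_{s(e)=v}ee^*$ whenever $s^{-1}(v)$ is finite and nonempty; it is $\mathbb Z$-graded by $\deg v=0$, $\deg e=1$, $\deg e^*=-1$. Then the embedding $\iota\colon L_K(E)\to M_\infty(L_K(E))(\overline\delta)$ into the $(1,1)$ corner induces, by the same formula, an isomorphism of $\mathbb Z[x,x^{-1}]$-modules $K_0^{\mathrm{gr}}(L_K(E))\to K_0^{\mathrm{gr}}\big(M_\infty(L_K(E))(\overline\delta)\big)$ which is an order isomorphism. -/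

import Mathlib

universe u v w

namespace GradedKTheory

open MulOpposite TensorProduct

/-! ### Gradings by a family of additive subgroups -/

section Gradings

variable {Γ : Type v} {M : Type u} [AddCommGroup M]

open scoped Classical in
/-- The subgroups `ℳ γ` form a grading of the abelian group `M`: `M` is their internal
direct sum. -/
def IsGrading (ℳ : Γ → AddSubgroup M) : Prop :=
  DirectSum.IsInternal ℳ

/-- The map sending `m = ∑ m_γ` to the family of its homogeneous components. -/
theorem IsGrading.exists_components {ℳ : Γ → AddSubgroup M} (h : IsGrading ℳ) :
    ∃ ρ : M →+ (Γ →₀ M), ∀ γ, ∀ x ∈ ℳ γ, ρ x = Finsupp.single γ x := by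
  classical
  have h' : Function.Bijective (DirectSum.coeAddMonoidHom ℳ) := by
    unfold IsGrading DirectSum.IsInternal at h
    convert h
  let e := AddEquiv.ofBijective (DirectSum.coeAddMonoidHom ℳ) h'
  let g : DirectSum Γ (fun γ => ℳ γ) →+ (Γ →₀ M) :=
    DirectSum.toAddMonoid fun γ => (Finsupp.singleAddHom γ).comp (ℳ γ).subtype
  refine ⟨g.comp e.symm.toAddMonoidHom, fun γ x hx => ?_⟩
  have : e.symm x = DirectSum.of (fun γ => ℳ γ) γ ⟨x, hx⟩ := by
    rw [AddEquiv.symm_apply_eq]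
    simp [e]
  simp [this, g]

theorem IsGrading.of_components' {N : Type*} [AddCommGroup N] {ℳ : Γ → AddSubgroup M}
    (j : M →+ N) (hj : Function.Injective j) (ρ : M →+ (Γ →₀ N))
    (hρ : ∀ γ, ∀ x ∈ ℳ γ, ρ x = Finsupp.single γ (j x)) (htop : ∀ x, x ∈ ⨆ γ, ℳ γ) :
    IsGrading ℳ := by
  classical
  unfold IsGrading DirectSum.IsInternal
  have key : ∀ (x : DirectSum Γ (fun γ => ℳ γ)) (γ : Γ),
      ρ (DirectSum.coeAddMonoidHom ℳ x) γ = j (x γ) := by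
    intro x γ
    induction x using DirectSum.induction_on with
    | zero => simp
    | of i x =>
      rw [DirectSum.coeAddMonoidHom_of, hρ i _ x.2, DirectSum.coe_of_apply, Finsupp.single_apply]
      split_ifs <;> simp
    | add x y hx hy => simp [hx, hy]
  suffices h' : Function.Bijective (DirectSum.coeAddMonoidHom ℳ) by convert h'
  constructor
  · intro x y hxy
    refine DFinsupp.ext fun γ => Subtype.ext (hj ?_)
    rw [← key x γ, ← key y γ, hxy]
  · intro x
    induction htop x using AddSubgroup.iSup_induction' with
    | hp i x hx => exact ⟨DirectSum.of (fun γ => ℳ γ) i ⟨x, hx⟩, by simp⟩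
    | h1 => exact ⟨0, map_zero _⟩
    | hadd x y _ _ hx hy =>
      obtain ⟨a, rfl⟩ := hx
      obtain ⟨b, rfl⟩ := hy
      exact ⟨a + b, map_add _ _ _⟩

theorem IsGrading.of_components {ℳ : Γ → AddSubgroup M} (ρ : M →+ (Γ →₀ M))
    (hρ : ∀ γ, ∀ x ∈ ℳ γ, ρ x = Finsupp.single γ x) (htop : ∀ x, x ∈ ⨆ γ, ℳ γ) :
    IsGrading ℳ :=
  IsGrading.of_components' (AddMonoidHom.id M) Function.injective_id ρ hρ htop

theorem IsGrading.mem_iSup {ℳ : Γ → AddSubgroup M} (h : IsGrading ℳ) (x : M) :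
    x ∈ ⨆ γ, ℳ γ := by
  classical
  have h' : Function.Bijective (DirectSum.coeAddMonoidHom ℳ) := by
    unfold IsGrading DirectSum.IsInternal at h
    convert h
  obtain ⟨y, rfl⟩ := h'.2 x
  induction y using DirectSum.induction_on with
  | zero => simp
  | of i x => simpa using AddSubgroup.mem_iSup_of_mem i x.2
  | add x y hx hy => simpa using add_mem hx hy

/-- Induction on homogeneous elements. -/
theorem IsGrading.induction [Zero Γ] {ℳ : Γ → AddSubgroup M} (h : IsGrading ℳ) {p : M → Prop}
    (hom : ∀ γ, ∀ x ∈ ℳ γ, p x) (add : ∀ x y, p x → p y → p (x + y)) (x : M) : p x := by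
  induction h.mem_iSup x using AddSubgroup.iSup_induction' with
  | hp i x hx => exact hom i x hx
  | h1 => exact hom 0 0 (zero_mem _)
  | hadd x y _ _ hx hy => exact add x y hx hy

/-- A `Γ`-grading of a (possibly non-unital) ring `A`: `A = ⨁ A_γ` and
`A_γ A_μ ⊆ A_{γ + μ}`. -/
class IsRingGrading [AddCommGroup Γ] {A : Type u} [NonUnitalRing A] (𝒜 : Γ → AddSubgroup A) : Prop where
  isGrading : IsGrading 𝒜
  mul_mem : ∀ {γ μ : Γ} {a b : A}, a ∈ 𝒜 γ → b ∈ 𝒜 μ → a * b ∈ 𝒜 (γ + μ)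

end Gradings

/-! ### The unitization `ℤ ⊕ A` of a graded ring -/

section Unit

/-- The unitization `ℤ ⊕ A` of the (possibly non-unital) ring `A`. -/
def ZUnit (A : Type u) [NonUnitalRing A] : Type u := Unitization ℤ A

variable {Γ : Type v} [AddCommGroup Γ] {A : Type u} [NonUnitalRing A]

namespace ZUnit

instance : Ring (ZUnit A) := inferInstanceAs (Ring (Unitization ℤ A))

/-- The projection `ℤ ⊕ A → ℤ`. -/
def fst : ZUnit A →+* ℤ where
  toFun x := (show Unitization ℤ A from x).toProd.1
  map_one' := rfl
  map_mul' _ _ := rfl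
  map_zero' := rfl
  map_add' _ _ := rfl

/-- The projection `ℤ ⊕ A → A`. -/
def snd : ZUnit A →+ A where
  toFun x := (show Unitization ℤ A from x).toProd.2
  map_zero' := rfl
  map_add' _ _ := rfl

/-- The inclusion of `A` as an ideal of `ℤ ⊕ A`. -/
def inr : A →ₙ+* ZUnit A where
  toFun a := (Unitization.inr a : Unitization ℤ A)
  map_zero' := Unitization.inr_zero ℤ
  map_add' := Unitization.inr_add ℤ
  map_mul' := Unitization.inr_mul ℤ

@[ext] theorem ext {x y : ZUnit A} (h1 : fst x = fst y) (h2 : snd x = snd y) : x = y :=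
  Unitization.ext h1 h2

@[simp] theorem fst_inr (a : A) : fst (inr a) = 0 := rfl

@[simp] theorem snd_inr (a : A) : snd (inr a) = a := rfl

@[simp] theorem snd_one : snd (1 : ZUnit A) = 0 := rfl

@[simp] theorem snd_intCast (n : ℤ) : snd (n : ZUnit A) = 0 := by
  rw [← zsmul_one, map_zsmul, snd_one, smul_zero]

@[simp] theorem snd_mul (x y : ZUnit A) :
    snd (x * y) = fst x • snd y + fst y • snd x + snd x * snd y := rfl

theorem eq_add (x : ZUnit A) : x = (fst x : ZUnit A) + inr (snd x) := by
  ext <;> simp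

/-- The unital extension `ℤ ⊕ A → ℤ ⊕ B` of a homomorphism of non-unital rings. -/
def map {B : Type w} [NonUnitalRing B] (f : A →ₙ+* B) : ZUnit A →+* ZUnit B where
  toFun x := (fst x : ZUnit B) + inr (f (snd x))
  map_one' := by ext <;> simp
  map_mul' x y := by
    ext
    · simp
    · simp [add_mul, mul_add]; abel
  map_zero' := by ext <;> simp
  map_add' x y := by ext <;> simp

@[simp] theorem fst_map {B : Type w} [NonUnitalRing B] (f : A →ₙ+* B) (x : ZUnit A) :
    fst (map f x) = fst x := by simp [map]

@[simp] theorem snd_map {B : Type w} [NonUnitalRing B] (f : A →ₙ+* B) (x : ZUnit A) :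
    snd (map f x) = f (snd x) := by simp [map]

/-- The grading of `ℤ ⊕ A` in which `ℤ` has degree `0`. -/
def grading (𝒜 : Γ → AddSubgroup A) (γ : Γ) : AddSubgroup (ZUnit A) where
  carrier := {x | snd x ∈ 𝒜 γ ∧ (γ ≠ 0 → fst x = 0)}
  zero_mem' := by simp [zero_mem]
  add_mem' := by
    rintro x y ⟨hx, hx'⟩ ⟨hy, hy'⟩
    exact ⟨by simpa using add_mem hx hy, fun h => by simp [hx' h, hy' h]⟩
  neg_mem' := by
    rintro x ⟨hx, hx'⟩
    exact ⟨by simpa using hx, fun h => by simp [hx' h]⟩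

theorem isGrading (𝒜 : Γ → AddSubgroup A) [h : IsRingGrading 𝒜] :
    IsGrading (grading 𝒜) := by
  obtain ⟨ρ, hρ⟩ := h.isGrading.exists_components
  let i : A →+ ZUnit A := AddMonoidHomClass.toAddMonoidHom (inr (A := A))
  let k : ℤ →+ ZUnit A := (Int.castRingHom (ZUnit A)).toAddMonoidHom
  refine IsGrading.of_components
    (((Finsupp.singleAddHom 0).comp k).comp fst.toAddMonoidHom +
      ((Finsupp.mapRange.addMonoidHom i).comp ρ).comp snd) ?_ ?_
  · rintro γ x ⟨hx, hx'⟩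
    have h1 : ρ (snd x) = Finsupp.single γ (snd x) := hρ γ _ hx
    have h2 : Finsupp.single (0 : Γ) (k (fst x)) = Finsupp.single γ (k (fst x)) := by
      by_cases hγ : γ = 0
      · rw [hγ]
      · simp [hx' hγ]
    change Finsupp.single (0 : Γ) (k (fst x)) + Finsupp.mapRange.addMonoidHom i (ρ (snd x)) = _
    rw [h1, h2, Finsupp.mapRange.addMonoidHom_apply, Finsupp.mapRange_single, ← Finsupp.single_add]
    congr 1
    exact (eq_add x).symm
  · intro x
    rw [eq_add x]
    refine add_mem (AddSubgroup.mem_iSup_of_mem 0 ⟨by simp [zero_mem], fun h => absurd rfl h⟩) ?_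
    refine h.isGrading.induction (p := fun a => inr a ∈ ⨆ γ, grading 𝒜 γ) ?_ ?_ (snd x)
    · intro γ a ha
      exact AddSubgroup.mem_iSup_of_mem γ ⟨ha, fun _ => rfl⟩
    · intro a b ha hb
      rw [map_add]
      exact add_mem ha hb

theorem mul_mem (𝒜 : Γ → AddSubgroup A) [h : IsRingGrading 𝒜] {γ μ : Γ}
    {x y : ZUnit A} (hx : x ∈ grading 𝒜 γ) (hy : y ∈ grading 𝒜 μ) :
    x * y ∈ grading 𝒜 (γ + μ) := by
  obtain ⟨hx, hx'⟩ := hx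
  obtain ⟨hy, hy'⟩ := hy
  constructor
  · rw [snd_mul]
    refine add_mem (add_mem ?_ ?_) (h.mul_mem hx hy)
    · by_cases hγ : γ = 0
      · subst hγ; rw [zero_add]; exact zsmul_mem hy _
      · rw [hx' hγ, zero_smul]; exact zero_mem _
    · by_cases hμ : μ = 0
      · subst hμ; rw [add_zero]; exact zsmul_mem hx _
      · rw [hy' hμ, zero_smul]; exact zero_mem _
  · intro hne
    rw [map_mul]
    by_cases hγ : γ = 0
    · have : μ ≠ 0 := fun hμ => hne (by simp [hγ, hμ])
      simp [hy' this]
    · simp [hx' hγ]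

theorem inr_mem {𝒜 : Γ → AddSubgroup A} {γ : Γ} {a : A} (ha : a ∈ 𝒜 γ) : inr a ∈ grading 𝒜 γ :=
  ⟨ha, fun _ => rfl⟩

theorem map_mem {B : Type w} [NonUnitalRing B] {𝒜 : Γ → AddSubgroup A}
    {ℬ : Γ → AddSubgroup B} (f : A →ₙ+* B) (hf : ∀ γ, ∀ a ∈ 𝒜 γ, f a ∈ ℬ γ) {γ : Γ}
    {x : ZUnit A} (hx : x ∈ grading 𝒜 γ) : map f x ∈ grading ℬ γ :=
  ⟨by simpa using hf γ _ hx.1, fun h => by simpa using hx.2 h⟩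

end ZUnit

end Unit

/-! ### Extension of scalars along a homomorphism of (noncommutative) unital rings -/

section BaseChange

variable {R : Type u} {S : Type v} [Ring R] [Ring S] (f : R →+* S)
variable (P : Type w) [AddCommGroup P] [Module Rᵐᵒᵖ P]

/-- The subgroup generated by the elements `p ⊗ f(r) s - p r ⊗ s`. The factor `S` is written on
the left in Lean, in order to use the right `S`-module structure that Mathlib provides. -/
def balancing : Submodule Sᵐᵒᵖ (S ⊗[ℤ] P) where
  toAddSubmonoid := (AddSubgroup.closure
    {x | ∃ (r : R) (s : S) (p : P), x = (f r * s) ⊗ₜ[ℤ] p - s ⊗ₜ[ℤ] (op r • p)}).toAddSubmonoid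
  smul_mem' := by
    intro c x hx
    change x ∈ AddSubgroup.closure _ at hx
    change c • x ∈ AddSubgroup.closure _
    induction hx using AddSubgroup.closure_induction with
    | mem x hx =>
      obtain ⟨r, s, p, rfl⟩ := hx
      refine AddSubgroup.subset_closure ⟨r, c • s, p, ?_⟩
      rw [smul_sub, TensorProduct.smul_tmul', TensorProduct.smul_tmul', mul_smul_comm]
    | zero => rw [smul_zero]; exact zero_mem _
    | add x y _ _ hx hy => rw [smul_add]; exact add_mem hx hy
    | neg x _ hx => rw [smul_neg]; exact neg_mem hx

/-- The right `S`-module `P ⊗_R S`, where `S` is a left `R`-module through `f`. -/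
abbrev ScalarExt : Type _ := (S ⊗[ℤ] P) ⧸ balancing f P

variable {P}

/-- The element `p ⊗ s` of `P ⊗_R S`. -/
def ScalarExt.tmul (p : P) (s : S) : ScalarExt f P := (balancing f P).mkQ (s ⊗ₜ[ℤ] p)

theorem ScalarExt.tmul_smul (p : P) (r : R) (s : S) :
    tmul f (op r • p) s = tmul f p (f r * s) := by
  refine ((Submodule.Quotient.eq _).2 ?_).symm
  exact AddSubgroup.subset_closure ⟨r, s, p, rfl⟩

theorem ScalarExt.smul_tmul (p : P) (s t : S) : op t • tmul f p s = tmul f p (s * t) := by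
  unfold tmul
  rw [← map_smul, TensorProduct.smul_tmul', op_smul_eq_mul]

theorem ScalarExt.add_tmul (p q : P) (s : S) : tmul f (p + q) s = tmul f p s + tmul f q s := by
  simp [tmul, TensorProduct.tmul_add]

theorem ScalarExt.tmul_add (p : P) (s t : S) : tmul f p (s + t) = tmul f p s + tmul f p t := by
  simp [tmul, TensorProduct.add_tmul]

theorem ScalarExt.zero_tmul (s : S) : tmul f (0 : P) s = 0 := by
  simp [tmul]

theorem ScalarExt.tmul_zero (p : P) : tmul f p (0 : S) = 0 := by
  simp [tmul]

theorem ScalarExt.induction {m : ScalarExt f P → Prop} (tmul : ∀ p s, m (tmul f p s))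
    (add : ∀ x y, m x → m y → m (x + y)) (x : ScalarExt f P) : m x := by
  obtain ⟨x, rfl⟩ := (balancing f P).mkQ_surjective x
  induction x using TensorProduct.induction_on with
  | zero => rw [map_zero, ← ScalarExt.zero_tmul f (0 : S)]; exact tmul _ _
  | tmul s p => exact tmul p s
  | add x y hx hy => rw [map_add]; exact add _ _ hx hy

/-- Balanced biadditive maps out of `P × S` factor through `P ⊗_R S`. -/
theorem ScalarExt.exists_lift {N : Type*} [AddCommGroup N] (g : S →+ P →+ N)
    (hg : ∀ r s p, g (f r * s) p = g s (op r • p)) :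
    ∃ h : ScalarExt f P →+ N, ∀ p s, h (tmul f p s) = g s p := by
  have hz : ∀ (n : ℤ) (s : S) (p : P), g (n • s) p = g s (n • p) := fun n s p => by
    rw [map_zsmul, map_zsmul, AddMonoidHom.zsmul_apply]
  let g' : S ⊗[ℤ] P →+ N := TensorProduct.liftAddHom g hz
  refine ⟨QuotientAddGroup.lift (balancing f P).toAddSubgroup g' ?_, fun p s => ?_⟩
  · intro x hx
    change x ∈ AddSubgroup.closure _ at hx
    induction hx using AddSubgroup.closure_induction with
    | mem x hx =>
      obtain ⟨r, s, p, rfl⟩ := hx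
      simp [g', hg]
    | zero => simp
    | add x y _ _ hx hy => simp_all
    | neg x _ hx => simp_all
  · exact TensorProduct.liftAddHom_tmul g hz s p

instance ScalarExt.finite [Module.Finite Rᵐᵒᵖ P] : Module.Finite Sᵐᵒᵖ (ScalarExt f P) := by
  obtain ⟨t, ht⟩ := (inferInstance : Module.Finite Rᵐᵒᵖ P).fg_top
  classical
  refine ⟨⟨t.image fun p : P => ScalarExt.tmul f p (1 : S), ?_⟩⟩
  rw [eq_top_iff]
  rintro (x : ScalarExt f P) -
  induction x using ScalarExt.induction with
  | add x y hx hy => exact add_mem hx hy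
  | tmul p s =>
    have hp : p ∈ Submodule.span Rᵐᵒᵖ (t : Set P) := ht ▸ Submodule.mem_top
    induction hp using Submodule.span_induction generalizing s with
    | mem p hp =>
      rw [← one_mul s, ← ScalarExt.smul_tmul]
      exact Submodule.smul_mem _ _ (Submodule.subset_span (by simpa using ⟨p, hp, rfl⟩))
    | zero => rw [ScalarExt.zero_tmul]; exact zero_mem _
    | add p q _ _ hp hq => rw [ScalarExt.add_tmul]; exact add_mem (hp s) (hq s)
    | smul r p _ hp =>
      rw [← op_unop r, ScalarExt.tmul_smul]; exact hp _

instance ScalarExt.projective [Module.Projective Rᵐᵒᵖ P] :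
    Module.Projective Sᵐᵒᵖ (ScalarExt f P) := by
  refine .of_lifting_property'' fun g hg => ?_
  let F := ScalarExt f P →₀ Sᵐᵒᵖ
  let _ : Module Rᵐᵒᵖ F := Module.compHom F f.op
  let _ : Module Rᵐᵒᵖ (ScalarExt f P) := Module.compHom _ f.op
  have hF : ∀ (r : Rᵐᵒᵖ) (x : F), r • x = op (f r.unop) • x := fun _ _ => rfl
  have hT : ∀ (r : Rᵐᵒᵖ) (x : ScalarExt f P), r • x = op (f r.unop) • x := fun _ _ => rfl
  let g' : F →ₗ[Rᵐᵒᵖ] ScalarExt f P :=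
    { toFun := g, map_add' := map_add g, map_smul' := fun r x => by
        simp only [hF, hT, map_smul, RingHom.id_apply] }
  let i : P →ₗ[Rᵐᵒᵖ] ScalarExt f P :=
    { toFun := fun p => tmul f p 1, map_add' := fun p q => add_tmul f p q 1
      map_smul' := fun r p => by
        rw [RingHom.id_apply, hT, smul_tmul, ← op_unop r, tmul_smul]; simp }
  obtain ⟨j, hj⟩ := Module.projective_lifting_property g' i hg
  obtain ⟨h, hh⟩ := ScalarExt.exists_lift f (N := F) (P := P)
    (AddMonoidHom.mk' (fun s => AddMonoidHom.mk' (fun p => op s • j p) (by simp))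
      (fun s t => by ext p : 1; simp [add_smul])) (fun r s p => by
        have := hF (op r) (j p)
        simp [this, mul_smul])
  have hh : ∀ p s, h (tmul f p s) = op s • j p := hh
  refine ⟨{ toFun := h, map_add' := map_add h, map_smul' := fun s x => ?_ }, ?_⟩
  · rw [RingHom.id_apply]
    induction x using ScalarExt.induction with
    | add x y hx hy => simp only [smul_add, map_add, hx, hy]
    | tmul p t => rw [← op_unop s, smul_tmul, hh, hh, op_mul, mul_smul]
  · refine LinearMap.ext fun x => ?_
    change g (h x) = x
    induction x using ScalarExt.induction with
    | add x y hx hy => rw [map_add, map_add, hx, hy]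
    | tmul p t =>
      have : g (j p) = tmul f p 1 := LinearMap.congr_fun hj p
      rw [hh, map_smul, this, smul_tmul, one_mul]

variable {Γ : Type*} [AddCommGroup Γ]

/-- The grading of `P ⊗_R S`: the component of degree `γ` is generated by the `p ⊗ s` with
`p` and `s` homogeneous and `deg p + deg s = γ`. -/
def extGrading (𝒮 : Γ → AddSubgroup S) (𝓟 : Γ → AddSubgroup P) (γ : Γ) :
    AddSubgroup (ScalarExt f P) :=
  AddSubgroup.closure
    {x | ∃ α β : Γ, α + β = γ ∧ ∃ p ∈ 𝓟 α, ∃ s ∈ 𝒮 β, x = ScalarExt.tmul f p s}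

theorem isGrading_extGrading {ℛ : Γ → AddSubgroup R} {𝒮 : Γ → AddSubgroup S}
    {𝓟 : Γ → AddSubgroup P} (hR : IsGrading ℛ) (hS : IsGrading 𝒮) (hP : IsGrading 𝓟)
    (hSmul : ∀ {γ μ : Γ} {s t : S}, s ∈ 𝒮 γ → t ∈ 𝒮 μ → s * t ∈ 𝒮 (γ + μ))
    (hPmul : ∀ {γ μ : Γ} {p : P} {r : R}, p ∈ 𝓟 γ → r ∈ ℛ μ → op r • p ∈ 𝓟 (γ + μ))
    (hf : ∀ {γ : Γ} {r : R}, r ∈ ℛ γ → f r ∈ 𝒮 γ) :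
    IsGrading (extGrading f 𝒮 𝓟) := by
  obtain ⟨ρS, hρS⟩ := hS.exists_components
  obtain ⟨ρP, hρP⟩ := hP.exists_components
  let b (α β : Γ) : S →+ P →+ (Γ →₀ ScalarExt f P) :=
    AddMonoidHom.mk' (fun s => AddMonoidHom.mk'
      (fun p => Finsupp.single (α + β) (ScalarExt.tmul f p s))
      (fun p q => by simp [ScalarExt.add_tmul]))
      (fun s t => by ext p : 1; simp [ScalarExt.tmul_add])
  let c : (Γ →₀ S) →+ (Γ →₀ P) →+ (Γ →₀ ScalarExt f P) :=
    Finsupp.liftAddHom fun α => AddMonoidHom.flip (Finsupp.liftAddHom fun β => (b α β).flip)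
  let g : S →+ P →+ (Γ →₀ ScalarExt f P) := (c.comp ρS).compl₂ ρP
  have hg : ∀ {α β : Γ} {s : S} {p : P}, s ∈ 𝒮 α → p ∈ 𝓟 β →
      g s p = Finsupp.single (α + β) (ScalarExt.tmul f p s) := by
    intro α β s p hs hp
    simp [g, c, b, hρS α s hs, hρP β p hp]
  obtain ⟨ρ, hρ⟩ := ScalarExt.exists_lift f g (by
    intro r s p
    revert s p
    refine hR.induction (p := fun r => ∀ s p, g (f r * s) p = g s (op r • p)) ?_ ?_ r
    · intro γ r hr s
      refine hS.induction (p := fun s => ∀ p, g (f r * s) p = g s (op r • p)) ?_ ?_ s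
      · intro α s hs p
        refine hP.induction (p := fun p => g (f r * s) p = g s (op r • p)) ?_ ?_ p
        · intro β p hp
          rw [hg (hSmul (hf hr) hs) hp, hg hs (hPmul hp hr), ScalarExt.tmul_smul]
          congr 1
          abel
        · intro p q hp hq
          simp only [map_add, smul_add, hp, hq]
      · intro s t hs ht p
        simp only [mul_add, map_add, AddMonoidHom.add_apply, hs, ht]
    · intro r r' hr hr' s p
      simp only [map_add, add_mul, op_add, add_smul, AddMonoidHom.add_apply, hr, hr'])
  refine IsGrading.of_components ρ ?_ ?_
  · intro γ x hx
    induction hx using AddSubgroup.closure_induction with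
    | mem x hx =>
      obtain ⟨α, β, rfl, p, hp, s, hs, rfl⟩ := hx
      rw [hρ, hg hs hp, add_comm]
    | zero => simp
    | add x y _ _ hx hy => simp [hx, hy]
    | neg x _ hx => simp [hx]
  · intro x
    induction x using ScalarExt.induction with
    | add x y hx hy => exact add_mem hx hy
    | tmul p s =>
      revert s
      refine hP.induction
        (p := fun p => ∀ s, ScalarExt.tmul f p s ∈ ⨆ γ, extGrading f 𝒮 𝓟 γ) ?_ ?_ p
      · intro α p hp s
        refine hS.induction
          (p := fun s => ScalarExt.tmul f p s ∈ ⨆ γ, extGrading f 𝒮 𝓟 γ) ?_ ?_ s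
        · intro β s hs
          exact AddSubgroup.mem_iSup_of_mem (α + β)
            (AddSubgroup.subset_closure ⟨α, β, rfl, p, hp, s, hs, rfl⟩)
        · intro s t hs ht
          rw [ScalarExt.tmul_add]; exact add_mem hs ht
      · intro p q hp hq s
        rw [ScalarExt.add_tmul]; exact add_mem (hp s) (hq s)

end BaseChange

/-! ### Graded finitely generated projective modules and the graded Grothendieck group -/

section GrK0

variable {Γ : Type v} [AddCommGroup Γ] {A : Type u} [NonUnitalRing A]

/-- A unital graded finitely generated projective right module over the `Γ`-graded ring `A`.
As `A` need not have an identity, right `A`-modules are regarded, as usual, as right modules over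
`ℤ ⊕ A`, and unitality is the condition `P A = P`. -/
structure GradedProj (𝒜 : Γ → AddSubgroup A) : Type (max (u + 1) v) where
  carrier : Type u
  [addCommGroup : AddCommGroup carrier]
  [module : Module (ZUnit A)ᵐᵒᵖ carrier]
  deg : Γ → AddSubgroup carrier
  isGrading : IsGrading deg
  smul_mem : ∀ {γ μ : Γ} {p : carrier} {a : A}, p ∈ deg γ → a ∈ 𝒜 μ →
    op (ZUnit.inr a) • p ∈ deg (γ + μ)
  finite : Module.Finite (ZUnit A)ᵐᵒᵖ carrier
  projective : Module.Projective (ZUnit A)ᵐᵒᵖ carrier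
  unital : ∀ p : carrier, p ∈ AddSubgroup.closure
    {x | ∃ (q : carrier) (a : A), x = op (ZUnit.inr a) • q}

namespace GradedProj

attribute [instance] addCommGroup module finite projective

variable {𝒜 : Γ → AddSubgroup A}

/-- Graded isomorphism of graded modules. -/
def Iso (P Q : GradedProj 𝒜) : Prop :=
  ∃ e : P.carrier ≃ₗ[(ZUnit A)ᵐᵒᵖ] Q.carrier, ∀ γ p, e p ∈ Q.deg γ ↔ p ∈ P.deg γ

theorem Iso.refl (P : GradedProj 𝒜) : Iso P P := ⟨LinearEquiv.refl _ _, fun _ _ => Iff.rfl⟩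

theorem Iso.symm {P Q : GradedProj 𝒜} : Iso P Q → Iso Q P := fun ⟨e, he⟩ =>
  ⟨e.symm, fun γ q => by rw [← he, e.apply_symm_apply]⟩

theorem Iso.trans {P Q R : GradedProj 𝒜} : Iso P Q → Iso Q R → Iso P R :=
  fun ⟨e, he⟩ ⟨e', he'⟩ => ⟨e.trans e', fun γ p => by rw [← he, ← he']; rfl⟩

variable (𝒜) in
instance setoid : Setoid (GradedProj 𝒜) := ⟨Iso, Iso.refl, Iso.symm, Iso.trans⟩

variable (𝒜) in
/-- The zero module. -/
def zero : GradedProj 𝒜 where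
  carrier := PUnit
  deg _ := ⊥
  isGrading := IsGrading.of_components 0 (fun _ _ _ => Subsingleton.elim _ _)
    (fun _ => zero_mem _)
  smul_mem _ _ := zero_mem _
  finite := inferInstance
  projective := inferInstance
  unital _ := zero_mem _

/-- The direct sum, with `(P ⊕ Q)_γ = P_γ ⊕ Q_γ`. -/
def sum (P Q : GradedProj 𝒜) : GradedProj 𝒜 where
  carrier := P.carrier × Q.carrier
  deg γ := (P.deg γ).prod (Q.deg γ)
  isGrading := by
    obtain ⟨ρ, hρ⟩ := P.isGrading.exists_components
    obtain ⟨σ, hσ⟩ := Q.isGrading.exists_components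
    let i := AddMonoidHom.inl P.carrier Q.carrier
    let j := AddMonoidHom.inr P.carrier Q.carrier
    refine IsGrading.of_components
      (((Finsupp.mapRange.addMonoidHom i).comp ρ).coprod
        ((Finsupp.mapRange.addMonoidHom j).comp σ)) ?_ ?_
    · rintro γ ⟨p, q⟩ ⟨hp, hq⟩
      simp [hρ γ p hp, hσ γ q hq, i, j, ← Finsupp.single_add]
    · rintro ⟨p, q⟩
      have h1 : ∀ p : P.carrier,
          i p ∈ ⨆ γ, (P.deg γ).prod (Q.deg γ) :=
        P.isGrading.induction
          (fun γ p hp => AddSubgroup.mem_iSup_of_mem γ ⟨hp, zero_mem _⟩)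
          (fun x y hx hy => by rw [map_add]; exact add_mem hx hy)
      have h2 : ∀ q : Q.carrier,
          j q ∈ ⨆ γ, (P.deg γ).prod (Q.deg γ) :=
        Q.isGrading.induction
          (fun γ p hp => AddSubgroup.mem_iSup_of_mem γ ⟨zero_mem _, hp⟩)
          (fun x y hx hy => by rw [map_add]; exact add_mem hx hy)
      have := add_mem (h1 p) (h2 q)
      simpa [i, j] using this
  smul_mem hp ha := ⟨P.smul_mem hp.1 ha, Q.smul_mem hp.2 ha⟩
  finite := inferInstance
  projective := inferInstance
  unital := by
    rintro ⟨p, q⟩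
    let i := AddMonoidHom.inl P.carrier Q.carrier
    let j := AddMonoidHom.inr P.carrier Q.carrier
    have h1 : i p ∈ AddSubgroup.closure {x | ∃ (q : P.carrier × Q.carrier) (a : A),
        x = op (ZUnit.inr a) • q} := by
      induction P.unital p using AddSubgroup.closure_induction with
      | mem x hx =>
        obtain ⟨q, a, rfl⟩ := hx
        exact AddSubgroup.subset_closure ⟨i q, a, by simp [i]⟩
      | zero => rw [map_zero]; exact zero_mem _
      | add x y _ _ hx hy => rw [map_add]; exact add_mem hx hy
      | neg x _ hx => rw [map_neg]; exact neg_mem hx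
    have h2 : j q ∈ AddSubgroup.closure {x | ∃ (q : P.carrier × Q.carrier) (a : A),
        x = op (ZUnit.inr a) • q} := by
      induction Q.unital q using AddSubgroup.closure_induction with
      | mem x hx =>
        obtain ⟨q, a, rfl⟩ := hx
        exact AddSubgroup.subset_closure ⟨j q, a, by simp [j]⟩
      | zero => rw [map_zero]; exact zero_mem _
      | add x y _ _ hx hy => rw [map_add]; exact add_mem hx hy
      | neg x _ hx => rw [map_neg]; exact neg_mem hx
    have := add_mem h1 h2
    simpa [i, j] using this

/-- The suspension `P(γ)`, with `P(γ)_μ = P_{γ + μ}`. -/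
def shift (γ : Γ) (P : GradedProj 𝒜) : GradedProj 𝒜 where
  carrier := P.carrier
  deg μ := P.deg (γ + μ)
  isGrading := by
    obtain ⟨ρ, hρ⟩ := P.isGrading.exists_components
    refine IsGrading.of_components
      ((Finsupp.mapDomain.addMonoidHom fun μ => μ - γ).comp ρ) ?_ ?_
    · intro μ p hp
      simp [hρ _ p hp, Finsupp.mapDomain_single]
    · refine P.isGrading.induction (fun μ p hp => ?_) fun x y hx hy => add_mem hx hy
      exact AddSubgroup.mem_iSup_of_mem (μ - γ) (by simpa using hp)
  smul_mem hp ha := by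
    have := P.smul_mem hp ha
    rwa [add_assoc] at this
  finite := P.finite
  projective := P.projective
  unital := P.unital

/-- The graded right `B`-module `P ⊗_A B` induced from `P` along a homomorphism of graded rings
`f : A → B`. It is formed over the unitizations; since `P A = P`, every `p ⊗ 1` is a sum of
elements `q ⊗ f(a)`. -/
def extend {B : Type u} [NonUnitalRing B] {ℬ : Γ → AddSubgroup B} [IsRingGrading 𝒜]
    [IsRingGrading ℬ] (f : A →ₙ+* B) (hf : ∀ γ, ∀ a ∈ 𝒜 γ, f a ∈ ℬ γ) (P : GradedProj 𝒜) :
    GradedProj ℬ where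
  carrier := ScalarExt (ZUnit.map f) P.carrier
  deg := extGrading (ZUnit.map f) (ZUnit.grading ℬ) P.deg
  isGrading := by
    refine isGrading_extGrading (ZUnit.map f) (ZUnit.isGrading 𝒜) (ZUnit.isGrading ℬ)
      P.isGrading (ZUnit.mul_mem ℬ) ?_ (ZUnit.map_mem f hf)
    rintro γ μ p r hp ⟨hr, hr'⟩
    rw [ZUnit.eq_add r, op_add, add_smul]
    refine add_mem ?_ (P.smul_mem hp hr)
    by_cases hμ : μ = 0
    · subst hμ
      rw [op_intCast, Int.cast_smul_eq_zsmul, add_zero]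
      exact zsmul_mem hp _
    · rw [hr' hμ, Int.cast_zero, op_zero, zero_smul]
      exact zero_mem _
  smul_mem := by
    intro γ μ x b hx hb
    induction hx using AddSubgroup.closure_induction with
    | mem x hx =>
      obtain ⟨α, β, rfl, p, hp, s, hs, rfl⟩ := hx
      rw [ScalarExt.smul_tmul]
      exact AddSubgroup.subset_closure ⟨α, β + μ, (add_assoc _ _ _).symm, p, hp, _,
        ZUnit.mul_mem ℬ hs (ZUnit.inr_mem hb), rfl⟩
    | zero => rw [smul_zero]; exact zero_mem _
    | add x y _ _ hx hy => rw [smul_add]; exact add_mem hx hy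
    | neg x _ hx => rw [smul_neg]; exact neg_mem hx
  finite := inferInstance
  projective := inferInstance
  unital x := by
    induction x using ScalarExt.induction with
    | add x y hx hy => exact add_mem hx hy
    | tmul p s =>
      induction P.unital p using AddSubgroup.closure_induction with
      | mem x hx =>
        obtain ⟨q, a, rfl⟩ := hx
        refine AddSubgroup.subset_closure
          ⟨ScalarExt.tmul _ q 1, ZUnit.snd (ZUnit.inr (f a) * s), ?_⟩
        rw [ScalarExt.tmul_smul, ScalarExt.smul_tmul, one_mul]
        congr 1
        ext <;> simp
      | zero => rw [ScalarExt.zero_tmul]; exact zero_mem _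
      | add x y _ _ hx hy => rw [ScalarExt.add_tmul]; exact add_mem hx hy
      | neg x _ hx =>
        have : ScalarExt.tmul (ZUnit.map f) (-x) s = -ScalarExt.tmul (ZUnit.map f) x s := by
          rw [eq_neg_iff_add_eq_zero, ← ScalarExt.add_tmul, neg_add_cancel, ScalarExt.zero_tmul]
        rw [this]; exact neg_mem hx

end GradedProj

/-- `𝒱^gr(A)`: graded isomorphism classes of unital graded finitely generated projective right
`A`-modules. -/
def GrV (𝒜 : Γ → AddSubgroup A) : Type (max (u + 1) v) := Quotient (GradedProj.setoid 𝒜)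

namespace GrV

variable {𝒜 : Γ → AddSubgroup A}

/-- The graded isomorphism class of `P`. -/
def mk (P : GradedProj 𝒜) : GrV 𝒜 := Quotient.mk _ P

theorem mk_eq_mk {P Q : GradedProj 𝒜} : mk P = mk Q ↔ P.Iso Q := Quotient.eq

instance : Zero (GrV 𝒜) := ⟨mk (GradedProj.zero 𝒜)⟩

/-- Addition is induced by the direct sum. -/
instance : Add (GrV 𝒜) := ⟨Quotient.map₂ GradedProj.sum (by
  rintro P P' ⟨e, he⟩ Q Q' ⟨g, hg⟩
  exact ⟨LinearEquiv.prodCongr e g, fun γ p => and_congr (he γ p.1) (hg γ p.2)⟩)⟩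

theorem mk_add_mk (P Q : GradedProj 𝒜) : mk P + mk Q = mk (P.sum Q) := rfl

instance : AddCommMonoid (GrV 𝒜) where
  add_assoc := by
    rintro ⟨P⟩ ⟨Q⟩ ⟨R⟩
    exact mk_eq_mk.2 ⟨LinearEquiv.prodAssoc _ _ _ _, fun γ p => by
      change _ ∧ _ ∧ _ ↔ (_ ∧ _) ∧ _
      rw [and_assoc]; rfl⟩
  zero_add := by
    rintro ⟨P⟩
    exact mk_eq_mk.2 ⟨@LinearEquiv.uniqueProd _ _ _ _ _ _ _ _ (inferInstanceAs (Unique PUnit)), fun γ p =>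
      (and_iff_right (Subsingleton.elim (α := PUnit) _ _)).symm⟩
  add_zero := by
    rintro ⟨P⟩
    exact mk_eq_mk.2 ⟨@LinearEquiv.prodUnique _ _ _ _ _ _ _ _ (inferInstanceAs (Unique PUnit)), fun γ p =>
      (and_iff_left (Subsingleton.elim (α := PUnit) _ _)).symm⟩
  add_comm := by
    rintro ⟨P⟩ ⟨Q⟩
    exact mk_eq_mk.2 ⟨LinearEquiv.prodComm _ _ _, fun γ p => and_comm⟩
  nsmul := nsmulRec

/-- The action of `γ` on `𝒱^gr(A)`: `γ [P] = [P(γ)]`. -/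
def shift (γ : Γ) : GrV 𝒜 →+ GrV 𝒜 where
  toFun := Quotient.map (GradedProj.shift γ) (by
    rintro P Q ⟨e, he⟩
    exact ⟨e, fun μ p => he (γ + μ) p⟩)
  map_zero' := mk_eq_mk.2 ⟨LinearEquiv.refl _ _, fun _ _ => Iff.rfl⟩
  map_add' := by
    rintro ⟨P⟩ ⟨Q⟩
    exact mk_eq_mk.2 ⟨LinearEquiv.refl _ _, fun _ _ => Iff.rfl⟩

theorem shift_mk (γ : Γ) (P : GradedProj 𝒜) : shift γ (mk P) = mk (P.shift γ) := rfl

theorem shift_zero (x : GrV 𝒜) : shift 0 x = x := by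
  obtain ⟨P⟩ := x
  exact mk_eq_mk.2 ⟨LinearEquiv.refl _ _, fun γ p => by
    change p ∈ P.deg γ ↔ p ∈ P.deg (0 + γ)
    rw [zero_add]⟩

theorem shift_add (γ μ : Γ) (x : GrV 𝒜) : shift (γ + μ) x = shift γ (shift μ x) := by
  obtain ⟨P⟩ := x
  exact mk_eq_mk.2 ⟨LinearEquiv.refl _ _, fun ν p => by
    change p ∈ P.deg (μ + (γ + ν)) ↔ p ∈ P.deg (γ + μ + ν)
    rw [add_left_comm, add_assoc]⟩

end GrV

/-- `K_0^gr(A)`: the group completion of `𝒱^gr(A)`. -/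
def GrK0 (𝒜 : Γ → AddSubgroup A) : Type (max (u + 1) v) :=
  Algebra.GrothendieckAddGroup (GrV 𝒜)

namespace GrK0

variable {𝒜 : Γ → AddSubgroup A}

instance : AddCommGroup (GrK0 𝒜) := inferInstanceAs (AddCommGroup (Algebra.GrothendieckAddGroup _))

/-- The canonical map `𝒱^gr(A) → K_0^gr(A)`. -/
def of : GrV 𝒜 →+ GrK0 𝒜 := Algebra.GrothendieckAddGroup.of

/-- The class `[P]` in `K_0^gr(A)`. -/
def mk (P : GradedProj 𝒜) : GrK0 𝒜 := of (GrV.mk P)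

theorem hom_ext {f g : GrK0 𝒜 →+ GrK0 𝒜} (h : ∀ x, f (of x) = g (of x)) : f = g :=
  (Algebra.GrothendieckAddGroup.lift (M := GrV 𝒜) (G := GrK0 𝒜)).symm.injective
    (AddMonoidHom.ext h)

/-- The endomorphism of `K_0^gr(A)` with `[P] ↦ [P(γ)]`. -/
noncomputable def shift (γ : Γ) : GrK0 𝒜 →+ GrK0 𝒜 :=
  Algebra.GrothendieckAddGroup.lift (of.comp (GrV.shift γ))

theorem shift_of (γ : Γ) (x : GrV 𝒜) : shift γ (of x) = of (GrV.shift γ x) :=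
  DFunLike.congr_fun (Algebra.GrothendieckAddGroup.lift.symm_apply_apply (of.comp (GrV.shift γ))) x

variable (𝒜) in
/-- The action of `Γ` on `K_0^gr(A)`. -/
noncomputable def shiftHom : Multiplicative Γ →* AddMonoid.End (GrK0 𝒜) where
  toFun γ := shift γ.toAdd
  map_one' := hom_ext fun x => by
    rw [shift_of, toAdd_one, GrV.shift_zero]; rfl
  map_mul' γ μ := hom_ext fun x => by
    change _ = shift _ (shift _ (of x))
    rw [shift_of, shift_of, shift_of, toAdd_mul, GrV.shift_add]

/-- The `ℤ[Γ]`-module structure of `K_0^gr(A)`. -/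
noncomputable instance : Module (AddMonoidAlgebra ℤ Γ) (GrK0 𝒜) :=
  Module.compHom _ (AddMonoidAlgebra.lift ℤ (AddMonoid.End (GrK0 𝒜)) Γ (shiftHom 𝒜)).toRingHom

theorem single_smul_mk (γ : Γ) (P : GradedProj 𝒜) :
    (AddMonoidAlgebra.single γ 1 : AddMonoidAlgebra ℤ Γ) • mk P = mk (P.shift γ) := by
  change AddMonoidAlgebra.lift ℤ (AddMonoid.End (GrK0 𝒜)) Γ (shiftHom 𝒜) _ (mk P) = _
  rw [AddMonoidAlgebra.lift_single, one_smul]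
  exact shift_of γ _

/-- The (pre)order of `K_0^gr(A)`, whose positive cone is the image of `𝒱^gr(A)`. -/
instance : Preorder (GrK0 𝒜) where
  le x y := ∃ v : GrV 𝒜, y = x + of v
  le_refl x := ⟨0, by simp⟩
  le_trans := by
    rintro x y z ⟨v, rfl⟩ ⟨w, rfl⟩
    exact ⟨v + w, by rw [map_add, add_assoc]⟩

theorem le_iff {x y : GrK0 𝒜} : x ≤ y ↔ ∃ P : GradedProj 𝒜, y - x = mk P := by
  constructor
  · rintro ⟨⟨P⟩, rfl⟩
    exact ⟨P, add_sub_cancel_left _ _⟩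
  · rintro ⟨P, h⟩
    exact ⟨GrV.mk P, (eq_add_of_sub_eq' h)⟩

end GrK0

end GrK0

/-! ### The graded matrix ring `M_∞(A)(δ)` -/

section Matrices

variable {Γ : Type v} [AddCommGroup Γ] {A : Type u} [NonUnitalRing A]

/-- `M_∞(A)`: matrices indexed by `ℕ × ℕ` with entries in `A`, finitely many of them nonzero. -/
def MatInf (A : Type u) [NonUnitalRing A] : Type u := ℕ × ℕ →₀ A

namespace MatInf

noncomputable instance : AddCommGroup (MatInf A) := inferInstanceAs (AddCommGroup (ℕ × ℕ →₀ A))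

instance : FunLike (MatInf A) (ℕ × ℕ) A := inferInstanceAs (FunLike (ℕ × ℕ →₀ A) (ℕ × ℕ) A)

@[simp] theorem add_apply (x y : MatInf A) (p : ℕ × ℕ) : (x + y) p = x p + y p := rfl

@[simp] theorem zero_apply (p : ℕ × ℕ) : (0 : MatInf A) p = 0 := rfl

@[simp] theorem neg_apply (x : MatInf A) (p : ℕ × ℕ) : (-x) p = -x p := rfl

@[ext] theorem ext {x y : MatInf A} (h : ∀ p, x p = y p) : x = y := DFunLike.ext _ _ h

/-- The matrix with entry `a` in position `(i, j)` and zeros elsewhere. -/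
noncomputable def unit (i j : ℕ) : A →+ MatInf A := Finsupp.singleAddHom (i, j)

theorem unit_apply (i j : ℕ) (a : A) (p : ℕ × ℕ) :
    unit i j a p = if (i, j) = p then a else 0 := Finsupp.single_apply

/-- A homomorphism out of `M_∞(A)` is determined by its values on the matrices `a e_{i,j}`. -/
noncomputable def lift {N : Type*} [AddCommGroup N] (f : ℕ → ℕ → A →+ N) : MatInf A →+ N :=
  Finsupp.liftAddHom fun p : ℕ × ℕ => f p.1 p.2

@[simp] theorem lift_unit {N : Type*} [AddCommGroup N] (f : ℕ → ℕ → A →+ N) (i j : ℕ) (a : A) :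
    lift f (unit i j a) = f i j a := Finsupp.liftAddHom_apply_single _ _ _

theorem induction {m : MatInf A → Prop} (unit : ∀ i j a, m (unit i j a))
    (add : ∀ x y, m x → m y → m (x + y)) (x : MatInf A) : m x :=
  Finsupp.induction_linear x (by have h := unit 0 0 0; rw [map_zero] at h; exact h) add fun p a => unit p.1 p.2 a

/-- Matrix multiplication: `(a e_{i,j}) (b e_{k,l})` is `a b e_{i,l}` if `j = k`, else `0`. -/
noncomputable def mulHom : MatInf A →+ MatInf A →+ MatInf A :=
  lift fun i j => AddMonoidHom.flip (lift fun k l => AddMonoidHom.flip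
    (if j = k then AddMonoidHom.mul.compr₂ (unit i l) else 0))

noncomputable instance : Mul (MatInf A) := ⟨fun x y => mulHom x y⟩

theorem unit_mul_unit (i j k l : ℕ) (a b : A) :
    unit i j a * unit k l b = if j = k then unit i l (a * b) else 0 := by
  change mulHom _ _ = _
  simp only [mulHom, lift_unit, AddMonoidHom.flip_apply]
  split_ifs <;> rfl

noncomputable instance : NonUnitalRing (MatInf A) where
  left_distrib x y z := map_add (mulHom x) y z
  right_distrib x y z := by
    change mulHom (x + y) z = mulHom x z + mulHom y z
    rw [map_add]; rfl
  zero_mul x := by change mulHom 0 x = 0; rw [map_zero]; rfl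
  mul_zero x := map_zero (mulHom x)
  mul_assoc x y z := by
    have hl : ∀ x y z : MatInf A, (x + y) * z = x * z + y * z := fun x y z => by
      change mulHom (x + y) z = mulHom x z + mulHom y z
      rw [map_add]; rfl
    have hr : ∀ x y z : MatInf A, x * (y + z) = x * y + x * z := fun x y z =>
      map_add (mulHom x) y z
    have h0 : ∀ x : MatInf A, x * 0 = 0 := fun x => map_zero (mulHom x)
    have h0' : ∀ x : MatInf A, 0 * x = 0 := fun x => by
      change mulHom 0 x = 0; rw [map_zero]; rfl
    induction x using MatInf.induction with
    | add x x' hx hx' => simp only [hl, hx, hx']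
    | unit i j a =>
      induction y using MatInf.induction with
      | add y y' hy hy' => simp only [hl, hr, hy, hy']
      | unit k l b =>
        induction z using MatInf.induction with
        | add z z' hz hz' => simp only [hr, hz, hz']
        | unit m n c =>
          simp only [unit_mul_unit]
          split_ifs <;> simp_all [unit_mul_unit, mul_assoc]

/-- The product is the usual product of matrices. -/
theorem mul_apply (x y : MatInf A) (i k : ℕ) : (x * y) (i, k) = ∑ᶠ j, x (i, j) * y (j, k) := by
  have hfin : ∀ (x y : MatInf A), (Function.support fun j => x (i, j) * y (j, k)).Finite := by
    intro x y
    have : (Function.support x).Finite := Finsupp.hasFiniteSupport (M := A) x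
    refine (this.image Prod.snd).subset fun j hj => ⟨(i, j), ?_, rfl⟩
    intro h0
    apply hj
    change x (i, j) * _ = 0
    rw [h0, zero_mul]
  induction x using MatInf.induction with
  | add x x' hx hx' =>
    simp only [add_mul, add_apply, hx, hx']
    rw [finsum_add_distrib (hfin x y) (hfin x' y)]
  | unit m n a =>
    induction y using MatInf.induction with
    | add y y' hy hy' =>
      simp only [mul_add, add_apply, hy, hy']
      rw [finsum_add_distrib (hfin _ y) (hfin _ y')]
    | unit p q b =>
      rw [unit_mul_unit, finsum_eq_single _ n]
      · simp only [unit_apply, Prod.mk.injEq]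
        split_ifs <;> simp_all [unit_apply]
      · intro j hj
        simp [unit_apply, Ne.symm hj]

variable (A) in
/-- The embedding `ι` of `A` into the upper left corner of `M_∞(A)`. -/
noncomputable def corner : A →ₙ+* MatInf A where
  toFun := unit 0 0
  map_zero' := map_zero _
  map_add' := map_add _
  map_mul' a b := by rw [unit_mul_unit, if_pos rfl]

/-- The grading of `M_∞(A)(δ)`: a matrix `x` has degree `γ` if and only if each entry `x_{i,j}`
has degree `γ + δ_j - δ_i`. -/
def grading (𝒜 : Γ → AddSubgroup A) (δ : ℕ → Γ) (γ : Γ) : AddSubgroup (MatInf A) where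
  carrier := {x | ∀ i j, x (i, j) ∈ 𝒜 (γ + δ j - δ i)}
  zero_mem' _ _ := zero_mem _
  add_mem' hx hy i j := add_mem (hx i j) (hy i j)
  neg_mem' hx i j := neg_mem (hx i j)

theorem corner_mem (𝒜 : Γ → AddSubgroup A) (δ : ℕ → Γ) (γ : Γ) (a : A) (ha : a ∈ 𝒜 γ) :
    corner A a ∈ grading 𝒜 δ γ := by
  intro i j
  change unit 0 0 a (i, j) ∈ _
  rw [unit_apply]
  split_ifs with h
  · obtain ⟨rfl, rfl⟩ := Prod.mk.inj h
    simpa using ha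
  · exact zero_mem _

instance (𝒜 : Γ → AddSubgroup A) [h : IsRingGrading 𝒜] (δ : ℕ → Γ) :
    IsRingGrading (grading 𝒜 δ) where
  isGrading := by
    obtain ⟨ρ, hρ⟩ := h.isGrading.exists_components
    let σ : MatInf A →+ (Γ →₀ MatInf A) := lift fun i j =>
      (Finsupp.liftAddHom fun μ =>
        (Finsupp.singleAddHom (μ - δ j + δ i)).comp (unit i j)).comp ρ
    have hσ : ∀ i j μ a, a ∈ 𝒜 μ →
        σ (unit i j a) = Finsupp.single (μ - δ j + δ i) (unit i j a) := by
      intro i j μ a ha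
      simp [σ, hρ μ a ha]
    have hsum : ∀ x : MatInf A, 
        x = ∑ p ∈ Finsupp.support (M := A) x, unit p.1 p.2 (x p) :=
      fun x => (Finsupp.sum_single (M := A) x).symm
    refine IsGrading.of_components σ ?_ ?_
    · intro γ x hx
      conv_lhs => rw [hsum x]
      conv_rhs => rw [hsum x]
      rw [← Finsupp.singleAddHom_apply, map_sum, map_sum]
      refine Finset.sum_congr rfl fun p _ => ?_
      rw [hσ p.1 p.2 _ _ (hx p.1 p.2), Finsupp.singleAddHom_apply]
      congr 1
      abel
    · intro x
      induction x using MatInf.induction with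
      | add x y hx hy => exact add_mem hx hy
      | unit i j a =>
        refine h.isGrading.induction (p := fun a => unit i j a ∈ _) ?_ ?_ a
        · intro μ a ha
          refine AddSubgroup.mem_iSup_of_mem (μ - δ j + δ i) fun k l => ?_
          rw [unit_apply]
          split_ifs with hp
          · obtain ⟨rfl, rfl⟩ := Prod.mk.inj hp
            have : μ - δ j + δ i + δ j - δ i = μ := by abel
            rwa [this]
          · exact zero_mem _
        · intro a b ha hb
          rw [map_add]; exact add_mem ha hb
  mul_mem := by
    intro γ μ x y hx hy i k
    rw [mul_apply]
    refine finsum_induction (· ∈ 𝒜 (γ + μ + δ k - δ i)) (zero_mem _)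
      (fun _ _ => add_mem) fun j => ?_
    have := h.mul_mem (hx i j) (hy j k)
    have e : γ + δ j - δ i + (μ + δ k - δ j) = γ + μ + δ k - δ i := by abel
    rwa [e] at this

end MatInf

end Matrices

/-! ### Leavitt path algebras -/

section Leavitt

/-- A directed graph `E = (E⁰, E¹, r, s)`. -/
structure DirectedGraph where
  V : Type u
  E : Type v
  r : E → V
  s : E → V

/-- The generators `v`, `e` and `e^*`, for `v ∈ E⁰` and `e ∈ E¹`. -/
inductive LeavittGen (G : DirectedGraph.{u, v}) : Type (max u v)
  | vertex (v : G.V)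
  | edge (e : G.E)
  | ghost (e : G.E)

variable (K : Type w) [Field K] (G : DirectedGraph.{u, v})

open LeavittGen in
/-- The defining relations of the Leavitt path algebra. -/
inductive LeavittRel :
    FreeAlgebra K (LeavittGen G) → FreeAlgebra K (LeavittGen G) → Prop
  | vertex_same (v : G.V) : LeavittRel
      (FreeAlgebra.ι K (vertex v) * FreeAlgebra.ι K (vertex v)) (FreeAlgebra.ι K (vertex v))
  | vertex_ne (v w : G.V) (h : v ≠ w) : LeavittRel
      (FreeAlgebra.ι K (vertex v) * FreeAlgebra.ι K (vertex w)) 0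
  | source_edge (e : G.E) : LeavittRel
      (FreeAlgebra.ι K (vertex (G.s e)) * FreeAlgebra.ι K (edge e)) (FreeAlgebra.ι K (edge e))
  | edge_range (e : G.E) : LeavittRel
      (FreeAlgebra.ι K (edge e) * FreeAlgebra.ι K (vertex (G.r e))) (FreeAlgebra.ι K (edge e))
  | range_ghost (e : G.E) : LeavittRel
      (FreeAlgebra.ι K (vertex (G.r e)) * FreeAlgebra.ι K (ghost e)) (FreeAlgebra.ι K (ghost e))
  | ghost_source (e : G.E) : LeavittRel
      (FreeAlgebra.ι K (ghost e) * FreeAlgebra.ι K (vertex (G.s e))) (FreeAlgebra.ι K (ghost e))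
  | ghost_edge_same (e : G.E) : LeavittRel
      (FreeAlgebra.ι K (ghost e) * FreeAlgebra.ι K (edge e)) (FreeAlgebra.ι K (vertex (G.r e)))
  | ghost_edge_ne (e f : G.E) (h : e ≠ f) : LeavittRel
      (FreeAlgebra.ι K (ghost e) * FreeAlgebra.ι K (edge f)) 0
  | regular (v : G.V) (S : Finset G.E) (hS : ∀ e, e ∈ S ↔ G.s e = v) (hne : S.Nonempty) :
      LeavittRel (FreeAlgebra.ι K (vertex v))
        (∑ e ∈ S, FreeAlgebra.ι K (edge e) * FreeAlgebra.ι K (ghost e))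

/-- The unital `K`-algebra presented by the Leavitt generators and relations. -/
abbrev LeavittUnital : Type _ := RingQuot (LeavittRel K G)

variable {G} in
/-- The image of a generator. -/
noncomputable def leavittGen (x : LeavittGen G) : LeavittUnital K G :=
  RingQuot.mkAlgHom K (LeavittRel K G) (FreeAlgebra.ι K x)

/-- The non-unital subalgebra generated by the Leavitt generators. -/
def leavittSubalgebra : NonUnitalSubalgebra K (LeavittUnital K G) :=
  NonUnitalAlgebra.adjoin K (Set.range (leavittGen K (G := G)))

/-- The Leavitt path algebra `L_K(E)`, the (in general non-unital) `K`-algebra presented by the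
Leavitt generators and relations: no relation involves the identity of the free unital algebra,
so `L_K(E)` is the non-unital subalgebra generated by the generators. -/
def LeavittPathAlgebra : Type (max w u v) := leavittSubalgebra K G

instance : NonUnitalRing (LeavittPathAlgebra K G) :=
  inferInstanceAs (NonUnitalRing (leavittSubalgebra K G))

instance : Module K (LeavittPathAlgebra K G) :=
  inferInstanceAs (Module K (leavittSubalgebra K G))

instance : IsScalarTower K (LeavittPathAlgebra K G) (LeavittPathAlgebra K G) :=
  inferInstanceAs (IsScalarTower K (leavittSubalgebra K G) (leavittSubalgebra K G))

instance : SMulCommClass K (LeavittPathAlgebra K G) (LeavittPathAlgebra K G) :=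
  inferInstanceAs (SMulCommClass K (leavittSubalgebra K G) (leavittSubalgebra K G))

/-- The inclusion of `L_K(E)` into the unital algebra with the same presentation. -/
def LeavittPathAlgebra.val : LeavittPathAlgebra K G →ₙ+* LeavittUnital K G where
  toFun := Subtype.val
  map_zero' := rfl
  map_add' _ _ := rfl
  map_mul' _ _ := rfl

/-- The degree of a generator. -/
def LeavittGen.degree {G : DirectedGraph.{u, v}} : LeavittGen G → ℤ
  | vertex _ => 0
  | edge _ => 1
  | ghost _ => -1

/-- `IsWord K G n x`: the element `x` is a nonempty product of generators, of total degree `n`. -/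
inductive IsWord : ℤ → LeavittUnital K G → Prop
  | gen (x : LeavittGen G) : IsWord x.degree (leavittGen K x)
  | mul {m n : ℤ} {x y : LeavittUnital K G} : IsWord m x → IsWord n y → IsWord (m + n) (x * y)

/-- The canonical `ℤ`-grading of `L_K(E)`: the component of degree `n` is spanned by the words
of degree `n` in the generators, with `deg v = 0`, `deg e = 1` and `deg e^* = -1`. -/
def leavittGrading (n : ℤ) : AddSubgroup (LeavittPathAlgebra K G) :=
  (Submodule.span K {y | IsWord K G n y}).toAddSubgroup.comap
    (AddMonoidHomClass.toAddMonoidHom (LeavittPathAlgebra.val K G))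

theorem IsWord.mem {n : ℤ} {x : LeavittUnital K G} (h : IsWord K G n x) :
    x ∈ leavittSubalgebra K G := by
  induction h with
  | gen x => exact NonUnitalAlgebra.subset_adjoin K ⟨x, rfl⟩
  | mul _ _ hx hy => exact mul_mem hx hy

/-- The coaction `x ↦ x t^n` for `x` of degree `n`. -/
theorem exists_leavittCoaction :
    ∃ φ : LeavittUnital K G →ₐ[K] AddMonoidAlgebra (LeavittUnital K G) ℤ,
    ∀ x, φ (leavittGen K x) = AddMonoidAlgebra.single x.degree (leavittGen K x) := by
  let ψ : FreeAlgebra K (LeavittGen G) →ₐ[K] AddMonoidAlgebra (LeavittUnital K G) ℤ :=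
    FreeAlgebra.lift K fun x => AddMonoidAlgebra.single x.degree (leavittGen K x)
  have hrel : ∀ {a b}, LeavittRel K G a b →
      RingQuot.mkAlgHom K (LeavittRel K G) a = RingQuot.mkAlgHom K (LeavittRel K G) b :=
    fun h => RingQuot.mkAlgHom_rel K h
  have hψ : ∀ ⦃a b⦄, LeavittRel K G a b → ψ a = ψ b := by
    intro a b h
    have h' := hrel h
    cases h <;>
      simp only [map_mul, map_zero, map_sum, ψ, FreeAlgebra.lift_ι_apply,
        AddMonoidAlgebra.single_mul_single, LeavittGen.degree] at h' ⊢
    case regular v S hS hne =>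
      change leavittGen K _ = ∑ e ∈ S, leavittGen K _ * leavittGen K _ at h'
      rw [h', ← AddMonoidAlgebra.singleAddHom_apply, map_sum]
      simp
    all_goals
      first
      | change leavittGen K _ * leavittGen K _ = leavittGen K _ at h'
        rw [h']; simp
      | change leavittGen K _ * leavittGen K _ = 0 at h'
        rw [h']; simp
  refine ⟨RingQuot.liftAlgHom K ⟨ψ, hψ⟩, fun x => ?_⟩
  simp [leavittGen, ψ]

instance : IsRingGrading (leavittGrading K G) where
  isGrading := by
    obtain ⟨φ, hφ⟩ := exists_leavittCoaction K G
    have hword : ∀ n x, IsWord K G n x → φ x = AddMonoidAlgebra.single n x := by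
      intro n x h
      induction h with
      | gen x => exact hφ x
      | mul _ _ hx hy => rw [map_mul, hx, hy, AddMonoidAlgebra.single_mul_single]
    let j : LeavittPathAlgebra K G →+ LeavittUnital K G :=
      AddMonoidHomClass.toAddMonoidHom (LeavittPathAlgebra.val K G)
    let c : AddMonoidAlgebra (LeavittUnital K G) ℤ →+ (ℤ →₀ LeavittUnital K G) :=
      ⟨⟨AddMonoidAlgebra.coeff, rfl⟩, fun _ _ => rfl⟩
    have hj : Function.Injective j := Subtype.val_injective
    refine IsGrading.of_components' j hj
      ((c.comp φ.toRingHom.toAddMonoidHom).comp j) ?_ ?_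
    · intro n x hx
      change j x ∈ Submodule.span K _ at hx
      change (φ (j x)).coeff = Finsupp.single n (j x)
      generalize j x = x at hx
      induction hx using Submodule.span_induction with
      | mem x hx => rw [hword n x hx]; rfl
      | zero => simp
      | add x y _ _ hx hy => rw [map_add, AddMonoidAlgebra.coeff_add, hx, hy, Finsupp.single_add]
      | smul a x _ hx => rw [map_smul, AddMonoidAlgebra.coeff_smul, hx, Finsupp.smul_single]
    · intro x
      have hx : ∀ y ∈ leavittSubalgebra K G, y ∈ Submodule.span K {y | ∃ n, IsWord K G n y} := by
        intro y hy
        induction hy using NonUnitalAlgebra.adjoin_induction with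
        | mem x hx =>
          obtain ⟨g, rfl⟩ := hx
          exact Submodule.subset_span ⟨_, IsWord.gen g⟩
        | add x y _ _ hx hy => exact add_mem hx hy
        | zero => exact zero_mem _
        | smul a x _ hx => exact Submodule.smul_mem _ _ hx
        | mul x y _ _ hx hy =>
          have := Submodule.mul_mem_mul hx hy
          rw [Submodule.span_mul_span] at this
          refine Submodule.span_mono ?_ this
          rintro _ ⟨x, ⟨m, hx⟩, y, ⟨n, hy⟩, rfl⟩
          exact ⟨m + n, hx.mul hy⟩
      suffices h : ∀ y ∈ Submodule.span K {y | ∃ n, IsWord K G n y},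
          ∃ z ∈ ⨆ n, leavittGrading K G n, j z = y by
        obtain ⟨z, hz, hzx⟩ := h (j x) (hx _ x.2)
        rwa [← hj hzx]
      intro y hy
      induction hy using Submodule.closure_induction with
      | zero => exact ⟨0, zero_mem _, map_zero _⟩
      | add x y _ _ hx hy =>
        obtain ⟨a, ha, rfl⟩ := hx
        obtain ⟨b, hb, rfl⟩ := hy
        exact ⟨a + b, add_mem ha hb, map_add _ _ _⟩
      | smul_mem c x hx =>
        obtain ⟨n, hx⟩ := hx
        exact ⟨⟨c • x, SMulMemClass.smul_mem c (IsWord.mem K G hx)⟩, AddSubgroup.mem_iSup_of_mem n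
          (Submodule.smul_mem _ c (Submodule.subset_span hx)), rfl⟩
  mul_mem := by
    intro m n x y hx hy
    change LeavittPathAlgebra.val K G x ∈ Submodule.span K _ at hx
    change LeavittPathAlgebra.val K G y ∈ Submodule.span K _ at hy
    change LeavittPathAlgebra.val K G (x * y) ∈ Submodule.span K _
    rw [map_mul]
    have := Submodule.mul_mem_mul hx hy
    rw [Submodule.span_mul_span] at this
    refine Submodule.span_mono ?_ this
    rintro _ ⟨x, hx, y, hy, rfl⟩
    exact IsWord.mul hx hy

end Leavitt

end GradedKTheory

/-! The theorem is a graded Morita equivalence between `A` and the corner ι(A) of M = M_∞(A)(δ).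
Write a E_{kl} for `unit k l a`, with indices from 0, so ι(a) = a E_{00}. The inverse of P ↦ P ⊗_A M
is Q ↦ Q ι(A). Neither ring need have an identity, so the idempotent E_{00} and the identity matrix
are not available. Common two-sided units of degree 0 for finite subsets of `A` take the place of
the identity of `A`, and the matrices `diag N f` take the place of the identity matrix.

Three facts carry the proof. Q ι(A) is again finitely generated projective: a dual basis of Q over
M, cut down to first columns, is one of Q ι(A) over `A` (`exists_dualBasis_unitalPart`).
Multiplication Q ι(A) ⊗_A M → Q is a graded isomorphism (`extend_restrictCorner_iso`), because the
corner is full: a E_{ij} = (e E_{i0})(a E_{0j}) whenever ea = a. And p ↦ p ⊗ 1 is a graded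
isomorphism of P onto (P ⊗_A M) ι(A) (`restrictCorner_extend_iso`). The shift δ does no harm, since
all these maps preserve degrees and the corner sits at a diagonal position.

Restriction visibly respects direct sums and suspensions, so it gives a bijective homomorphism of
the monoids 𝒱^gr commuting with Γ; the map of the theorem is its inverse, and is therefore additive
and equivariant as well. An isomorphism of the monoids passes to the group completions and matches
the positive cones, which are the images of the monoids. It remains to find local units: the e_n in
the first part, finite sums of vertices for Leavitt path algebras. -/

namespace GradedKTheory

open MulOpposite TensorProduct

/-! ### Graded maps -/

section Graded

variable {Γ : Type v} [AddCommGroup Γ]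

/-- An injective degree-preserving map between graded groups reflects degrees. -/
theorem IsGrading.mem_of_map_mem {M N : Type*} [AddCommGroup M] [AddCommGroup N]
    {ℳ : Γ → AddSubgroup M} {𝒩 : Γ → AddSubgroup N} (hM : IsGrading ℳ) (hN : IsGrading 𝒩)
    (j : M →+ N) (hj : Function.Injective j) (hdeg : ∀ γ, ∀ x ∈ ℳ γ, j x ∈ 𝒩 γ)
    {γ : Γ} {x : M} (hx : j x ∈ 𝒩 γ) : x ∈ ℳ γ := by
  classical
  obtain ⟨ρ, hρ⟩ := hM.exists_components
  obtain ⟨σ, hσ⟩ := hN.exists_components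
  have h1 : ∀ y μ, ρ y μ ∈ ℳ μ := by
    refine hM.induction ?_ ?_
    · intro ν y hy μ
      rw [hρ ν y hy, Finsupp.single_apply]
      split_ifs with h
      · exact h ▸ hy
      · exact zero_mem _
    · intro y z hy hz μ
      rw [map_add]
      exact add_mem (hy μ) (hz μ)
  have h2 : ∀ y μ, j (ρ y μ) = σ (j y) μ := by
    refine hM.induction ?_ ?_
    · intro ν y hy μ
      rw [hρ ν y hy, hσ ν _ (hdeg ν y hy), Finsupp.single_apply, Finsupp.single_apply]
      split_ifs <;> simp
    · intro y z hy hz μ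
      simp only [map_add, Finsupp.add_apply, hy, hz]
  -- As j x is concentrated in degree γ, it equals its own γ-component, which by `h2` is the image
  -- of the γ-component of x. Injectivity of j then identifies x with that component.
  have h3 : x = ρ x γ := hj (by rw [h2, hσ γ _ hx, Finsupp.single_eq_same])
  rw [h3]
  exact h1 x γ

variable {A : Type u} [NonUnitalRing A] {𝒜 : Γ → AddSubgroup A}

/-- `Iso` asks for an equivalence of degree conditions; since bijective maps that preserve degrees
also reflect them, one implication suffices. -/
theorem GradedProj.Iso.of_bijective {P Q : GradedProj 𝒜}
    (e : P.carrier →ₗ[(ZUnit A)ᵐᵒᵖ] Q.carrier) (he : Function.Bijective e)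
    (hdeg : ∀ γ, ∀ p ∈ P.deg γ, e p ∈ Q.deg γ) : P.Iso Q :=
  ⟨LinearEquiv.ofBijective e he, fun γ p =>
    ⟨fun h => P.isGrading.mem_of_map_mem Q.isGrading e.toAddMonoidHom he.1 hdeg h, hdeg γ p⟩⟩

end Graded

/-! ### Local units -/

section LocalUnits

/-- Every finite subset of `B` has a common two-sided unit. -/
def HasLocalUnits (B : Type u) [NonUnitalRing B] : Prop :=
  ∀ s : Finset B, ∃ f : B, ∀ b ∈ s, f * b = b ∧ b * f = b

variable {Γ : Type v} [AddCommGroup Γ] {A : Type u} [NonUnitalRing A]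

/-- Every finite subset of `A` has a common two-sided unit of degree `0`. -/
def HasGradedLocalUnits (𝒜 : Γ → AddSubgroup A) : Prop :=
  ∀ s : Finset A, ∃ f ∈ 𝒜 0, ∀ b ∈ s, f * b = b ∧ b * f = b

variable {𝒜 : Γ → AddSubgroup A}

theorem HasGradedLocalUnits.hasLocalUnits (h : HasGradedLocalUnits 𝒜) : HasLocalUnits A :=
  fun s => (h s).imp fun _ hf => hf.2

theorem HasLocalUnits.exists_unit (h : HasLocalUnits A) (a : A) : ∃ f, f * a = a ∧ a * f = a := by
  obtain ⟨f, hf⟩ := h {a}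
  exact ⟨f, hf a (Finset.mem_singleton_self a)⟩

theorem HasGradedLocalUnits.exists_unit (h : HasGradedLocalUnits 𝒜) (a : A) :
    ∃ f ∈ 𝒜 0, f * a = a ∧ a * f = a := by
  obtain ⟨f, hf0, hf⟩ := h {a}
  exact ⟨f, hf0, hf a (Finset.mem_singleton_self a)⟩

theorem HasLocalUnits.exists_unit₂ (h : HasLocalUnits A) (a b : A) :
    ∃ f, (f * a = a ∧ a * f = a) ∧ f * b = b ∧ b * f = b := by
  classical
  obtain ⟨f, hf⟩ := h {a, b}
  exact ⟨f, hf a (by simp), hf b (by simp)⟩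

/-- It suffices to have units for single elements. -/
theorem HasGradedLocalUnits.of_single [IsRingGrading 𝒜]
    (h : ∀ a : A, ∃ f ∈ 𝒜 0, f * a = a ∧ a * f = a) : HasGradedLocalUnits 𝒜 := by
  classical
  have hmul : ∀ {a b : A}, a ∈ 𝒜 0 → b ∈ 𝒜 0 → a * b ∈ 𝒜 0 := fun ha hb => by
    have := IsRingGrading.mul_mem (𝒜 := 𝒜) ha hb
    rwa [add_zero] at this
  intro s
  induction s using Finset.induction_on with
  | empty => exact ⟨0, zero_mem _, by simp⟩
  | insert x t _ ih =>
    obtain ⟨c, hc0, hc⟩ := ih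
    -- In the notation of a formal identity, c + e - ec = 1 - (1 - e)(1 - c). The factor 1 - c kills
    -- t on the left and turns x into the defect x - cx, which 1 - e kills. The element g does the
    -- same on the right for x - xc.
    obtain ⟨e, he0, he, -⟩ := h (x - c * x)
    obtain ⟨g, hg0, -, hg⟩ := h (x - x * c)
    have hl : ∀ b ∈ insert x t, (c + e - e * c) * b = b := by
      intro b hb
      rw [sub_mul, add_mul, mul_assoc]
      rcases Finset.mem_insert.1 hb with rfl | hb
      · rw [mul_sub] at he
        rw [add_sub_assoc, he]; abel
      · rw [(hc b hb).1]; abel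
    have hr : ∀ b ∈ insert x t, b * (c + g - c * g) = b := by
      intro b hb
      rw [mul_sub, mul_add, ← mul_assoc]
      rcases Finset.mem_insert.1 hb with rfl | hb
      · rw [sub_mul] at hg
        rw [add_sub_assoc, hg]; abel
      · rw [(hc b hb).2]; abel
    have hl0 : c + e - e * c ∈ 𝒜 0 := sub_mem (add_mem hc0 he0) (hmul he0 hc0)
    have hr0 : c + g - c * g ∈ 𝒜 0 := sub_mem (add_mem hc0 hg0) (hmul hc0 hg0)
    generalize c + e - e * c = l at hl hl0
    generalize c + g - c * g = r at hr hr0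
    -- This is 1 - (1 - r)(1 - l): a left unit l and a right unit r combine into a two-sided one.
    refine ⟨l + r - r * l, sub_mem (add_mem hl0 hr0) (hmul hr0 hl0), fun b hb => ⟨?_, ?_⟩⟩
    · rw [sub_mul, add_mul, mul_assoc, hl b hb]; abel
    · rw [mul_sub, mul_add, ← mul_assoc, hr b hb]; abel

/-- Finitely many elements of a unital module over a ring with local units have a common unit. -/
theorem HasLocalUnits.exists_unit_module (h : HasLocalUnits A) {P : Type*} [AddCommGroup P]
    [Module (ZUnit A)ᵐᵒᵖ P]
    (hP : ∀ p : P, p ∈ AddSubgroup.closure {x | ∃ (q : P) (a : A), x = op (ZUnit.inr a) • q})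
    (s : Finset P) : ∃ f : A, ∀ p ∈ s, op (ZUnit.inr f) • p = p := by
  classical
  have hmul : ∀ {a f : A} {p : P}, op (ZUnit.inr a) • p = p → a * f = a →
      op (ZUnit.inr f) • p = p := by
    intro a f p hp hf
    conv_lhs => rw [← hp]
    rw [smul_smul, ← op_mul, ← map_mul, hf, hp]
  -- The elements fixed by some a form a subgroup, because two fixing elements have a common unit,
  -- which by `hmul` fixes both summands. The subgroup contains each q·a, hence everything.
  have h1 : ∀ p : P, ∃ a : A, op (ZUnit.inr a) • p = p := by
    intro p
    induction hP p using AddSubgroup.closure_induction with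
    | mem x hx =>
      obtain ⟨q, a, rfl⟩ := hx
      obtain ⟨f, -, hf⟩ := h.exists_unit a
      exact ⟨f, by rw [smul_smul, ← op_mul, ← map_mul, hf]⟩
    | zero => exact ⟨0, smul_zero _⟩
    | add x y _ _ hx hy =>
      obtain ⟨a, ha⟩ := hx
      obtain ⟨b, hb⟩ := hy
      obtain ⟨f, hfa, hfb⟩ := h.exists_unit₂ a b
      exact ⟨f, by rw [smul_add, hmul ha hfa.2, hmul hb hfb.2]⟩
    | neg x _ hx =>
      obtain ⟨a, ha⟩ := hx
      exact ⟨a, by rw [smul_neg, ha]⟩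
  choose a ha using h1
  obtain ⟨f, hf⟩ := h (s.image a)
  exact ⟨f, fun p hp => hmul (ha p) (hf _ (Finset.mem_image_of_mem a hp)).2⟩

end LocalUnits

/-! ### Dual bases -/

section DualBasis

variable {B : Type u} [NonUnitalRing B]

/-- `B` is an ideal of ℤ ⊕ B. This is what allows functionals with values in ℤ ⊕ B to be replaced by
functionals with values in `B`. -/
theorem ZUnit.inr_snd_inr_mul (b : B) (s : ZUnit B) :
    ZUnit.inr (ZUnit.snd (ZUnit.inr b * s)) = ZUnit.inr b * s := by
  ext <;> simp

/-- A finite dual basis of a right `B`-module `P`, with functionals taking values in `B`. -/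
structure DualBasis (B : Type u) [NonUnitalRing B] (ι : Type) [Fintype ι] (P : Type w)
    [AddCommGroup P] [Module (ZUnit B)ᵐᵒᵖ P] where
  gen : ι → P
  coord : ι → P →+ B
  coord_smul : ∀ i (s : (ZUnit B)ᵐᵒᵖ) (p : P),
    ZUnit.inr (coord i (s • p)) = ZUnit.inr (coord i p) * s.unop
  sum_eq : ∀ p : P, ∑ i, op (ZUnit.inr (coord i p)) • gen i = p

namespace DualBasis

variable {ι : Type} [Fintype ι] {P : Type w} [AddCommGroup P] [Module (ZUnit B)ᵐᵒᵖ P]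

/-- The map `P → (ℤ ⊕ B)^ι` given by the coordinates. -/
def toPi (D : DualBasis B ι P) : P →ₗ[(ZUnit B)ᵐᵒᵖ] (ι → (ZUnit B)ᵐᵒᵖ) where
  toFun p i := op (ZUnit.inr (D.coord i p))
  map_add' p q := by ext i : 1; simp
  map_smul' s p := by
    ext i : 1
    rw [D.coord_smul, op_mul, op_unop]; rfl

theorem lift_comp_toPi (D : DualBasis B ι P) :
    (Fintype.linearCombination (ZUnit B)ᵐᵒᵖ D.gen).comp D.toPi = LinearMap.id :=
  LinearMap.ext fun p => D.sum_eq p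

theorem finite (D : DualBasis B ι P) : Module.Finite (ZUnit B)ᵐᵒᵖ P :=
  .of_surjective (Fintype.linearCombination (ZUnit B)ᵐᵒᵖ D.gen)
    fun p => ⟨D.toPi p, LinearMap.congr_fun D.lift_comp_toPi p⟩

theorem projective (D : DualBasis B ι P) : Module.Projective (ZUnit B)ᵐᵒᵖ P :=
  .of_split _ _ D.lift_comp_toPi

theorem unital (D : DualBasis B ι P) (p : P) :
    p ∈ AddSubgroup.closure {x | ∃ (q : P) (a : B), x = op (ZUnit.inr a) • q} := by
  rw [← D.sum_eq p]
  exact sum_mem fun i _ => AddSubgroup.subset_closure ⟨_, _, rfl⟩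

end DualBasis

/-- A splitting σ of a surjection from a finite free module has coordinates in ℤ ⊕ B. Multiplying
them on the left by a common unit f of the generators brings them into `B`, and the expansion of p
is unchanged because each generator satisfies g_i·f = g_i. -/
theorem exists_dualBasis (h : HasLocalUnits B) {P : Type w} [AddCommGroup P]
    [Module (ZUnit B)ᵐᵒᵖ P] [Module.Finite (ZUnit B)ᵐᵒᵖ P] [Module.Projective (ZUnit B)ᵐᵒᵖ P]
    (hP : ∀ p : P, p ∈ AddSubgroup.closure {x | ∃ (q : P) (a : B), x = op (ZUnit.inr a) • q}) :
    ∃ n, Nonempty (DualBasis B (Fin n) P) := by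
  classical
  obtain ⟨n, π, hπ⟩ := Module.Finite.exists_fin' (ZUnit B)ᵐᵒᵖ P
  obtain ⟨σ, hσ⟩ := Module.projective_lifting_property π LinearMap.id hπ
  let gen : Fin n → P := fun i => π (Pi.single i 1)
  obtain ⟨f, hf⟩ := h.exists_unit_module hP (Finset.univ.image gen)
  refine ⟨n, ⟨⟨gen, fun i => AddMonoidHom.mk'
    (fun p => ZUnit.snd (ZUnit.inr f * (σ p i).unop)) fun p q => ?_, fun i s p => ?_,
    fun p => ?_⟩⟩⟩
  · simp only [map_add, Pi.add_apply, unop_add, mul_add]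
  · simp only [AddMonoidHom.mk'_apply, ZUnit.inr_snd_inr_mul, map_smul, Pi.smul_apply,
      smul_eq_mul, unop_mul, mul_assoc]
  · have : π (σ p) = p := LinearMap.congr_fun hσ p
    conv_rhs => rw [← this, LinearMap.pi_apply_eq_sum_univ π]
    refine Finset.sum_congr rfl fun i _ => ?_
    have hgen : π (fun j => if i = j then 1 else 0) = gen i := by
      congr 1; ext j : 1; simp [Pi.single_apply, eq_comm]
    simp only [AddMonoidHom.mk'_apply, ZUnit.inr_snd_inr_mul, hgen]
    rw [op_mul, op_unop, mul_smul, hf _ (Finset.mem_image_of_mem gen (Finset.mem_univ i))]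

end DualBasis

/-! ### Restriction along a homomorphism of non-unital rings -/

section Restriction

variable {Γ : Type v} [AddCommGroup Γ] {A B : Type u} [NonUnitalRing A] [NonUnitalRing B]

/-- The part `Q f(A)` of a right `B`-module `Q`, for a homomorphism `f : A → B`. -/
def unitalPart (h : HasLocalUnits A) (f : A →ₙ+* B) (Q : Type w) [AddCommGroup Q]
    [Module (ZUnit B)ᵐᵒᵖ Q] : AddSubgroup Q where
  -- With local units, being fixed by some f(a) describes all of Q f(A): an element q·f(a) is fixed
  -- by f(e) as soon as ae = a.
  carrier := {q | ∃ a : A, op (ZUnit.inr (f a)) • q = q}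
  zero_mem' := ⟨0, smul_zero _⟩
  add_mem' := by
    rintro p q ⟨a, ha⟩ ⟨b, hb⟩
    obtain ⟨e, hea, heb⟩ := h.exists_unit₂ a b
    refine ⟨e, ?_⟩
    rw [smul_add]
    conv_lhs => rw [← ha, ← hb]
    rw [smul_smul, smul_smul, ← op_mul, ← op_mul, ← map_mul, ← map_mul, ← map_mul, ← map_mul,
      hea.2, heb.2, ha, hb]
  neg_mem' := by
    rintro p ⟨a, ha⟩
    exact ⟨a, by rw [smul_neg, ha]⟩

variable (h : HasLocalUnits A) (f : A →ₙ+* B)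

theorem ZUnit.map_inr (a : A) : ZUnit.map f (ZUnit.inr a) = ZUnit.inr (f a) := by
  ext <;> simp

theorem ZUnit.map_intCast_add_inr (n : ℤ) (a : A) :
    ZUnit.map f (n + ZUnit.inr a) = n + ZUnit.inr (f a) := by
  rw [map_add, map_intCast, ZUnit.map_inr]

section

variable {Q : Type w} [AddCommGroup Q] [Module (ZUnit B)ᵐᵒᵖ Q]

/-- Here b may lie outside f(A). The case of interest is a matrix supported in the first column,
which moves elements of Q into Q ι(A). -/
theorem smul_mem_unitalPart_of_mul_eq {b : B} {a : A} (hb : b * f a = b) (q : Q) :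
    op (ZUnit.inr b) • q ∈ unitalPart h f Q :=
  ⟨a, by rw [smul_smul, ← op_mul, ← map_mul, hb]⟩

theorem inr_smul_mem_unitalPart (a : A) (q : Q) :
    op (ZUnit.inr (f a)) • q ∈ unitalPart h f Q := by
  obtain ⟨e, -, he⟩ := h.exists_unit a
  exact smul_mem_unitalPart_of_mul_eq h f (by rw [← map_mul, he]) q

theorem map_smul_mem_unitalPart (r : (ZUnit A)ᵐᵒᵖ) {q : Q} (hq : q ∈ unitalPart h f Q) :
    op (ZUnit.map f r.unop) • q ∈ unitalPart h f Q := by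
  rw [ZUnit.eq_add r.unop, ZUnit.map_intCast_add_inr, op_add, add_smul, op_intCast,
    Int.cast_smul_eq_zsmul]
  exact add_mem (zsmul_mem hq _) (inr_smul_mem_unitalPart h f _ q)

instance : Module (ZUnit A)ᵐᵒᵖ (unitalPart h f Q) where
  smul r q := ⟨op (ZUnit.map f r.unop) • q.1, map_smul_mem_unitalPart h f r q.2⟩
  one_smul q := Subtype.ext (by
    change op (ZUnit.map f 1) • q.1 = q.1
    rw [map_one, op_one, one_smul])
  mul_smul r s q := Subtype.ext (by
    change op (ZUnit.map f (s.unop * r.unop)) • q.1 = op _ • op _ • q.1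
    rw [map_mul, op_mul, mul_smul])
  smul_zero r := Subtype.ext (smul_zero _)
  smul_add r p q := Subtype.ext (smul_add _ _ _)
  add_smul r s q := Subtype.ext (by
    change op (ZUnit.map f (r.unop + s.unop)) • q.1 = op _ • q.1 + op _ • q.1
    rw [map_add, op_add, add_smul])
  zero_smul q := Subtype.ext (by
    change op (ZUnit.map f 0) • q.1 = 0
    rw [map_zero, op_zero, zero_smul])

theorem coe_smul_unitalPart (r : (ZUnit A)ᵐᵒᵖ) (q : unitalPart h f Q) :
    ((r • q : unitalPart h f Q) : Q) = op (ZUnit.map f r.unop) • q.1 := rfl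

end

variable {𝒜 : Γ → AddSubgroup A} {ℬ : Γ → AddSubgroup B}

namespace GradedProj

/-- An element of Q f(A) is fixed by some f(e) with e of degree 0. Multiplication by f(e) preserves
degrees and lands in Q f(A), so it carries a homogeneous decomposition in Q to one inside Q f(A). -/
theorem isGrading_unitalPart (h : HasGradedLocalUnits 𝒜) (hf : ∀ γ, ∀ a ∈ 𝒜 γ, f a ∈ ℬ γ)
    (Q : GradedProj ℬ) : IsGrading fun γ =>
      (Q.deg γ).comap (unitalPart h.hasLocalUnits f Q.carrier).subtype := by
  obtain ⟨ρ, hρ⟩ := Q.isGrading.exists_components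
  refine IsGrading.of_components' (unitalPart h.hasLocalUnits f Q.carrier).subtype
    Subtype.val_injective (ρ.comp (unitalPart h.hasLocalUnits f Q.carrier).subtype)
    (fun γ x hx => hρ γ _ hx) ?_
  rintro ⟨q, a, ha⟩
  obtain ⟨e, he0, -, he⟩ := h.exists_unit a
  let c : Q.carrier →+ unitalPart h.hasLocalUnits f Q.carrier := AddMonoidHom.mk'
    (fun q => ⟨op (ZUnit.inr (f e)) • q, inr_smul_mem_unitalPart _ f e q⟩)
    fun p q => Subtype.ext (smul_add _ _ _)
  have hc : ∀ q, c q ∈ ⨆ γ, (Q.deg γ).comap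
      (unitalPart h.hasLocalUnits f Q.carrier).subtype := by
    refine Q.isGrading.induction ?_ ?_
    · intro γ q hq
      refine AddSubgroup.mem_iSup_of_mem γ ?_
      have := Q.smul_mem hq (hf 0 e he0)
      rwa [add_zero] at this
    · intro p q hp hq
      rw [map_add]
      exact add_mem hp hq
  convert hc q
  refine Subtype.ext ?_
  change q = op (ZUnit.inr (f e)) • q
  conv_rhs => rw [← ha]
  rw [smul_smul, ← op_mul, ← map_mul, ← map_mul, he, ha]

/-- The graded right `A`-module `Q f(A)`, provided that it has a finite dual basis. -/
def restrict (h : HasGradedLocalUnits 𝒜) (f : A →ₙ+* B) (hf : ∀ γ, ∀ a ∈ 𝒜 γ, f a ∈ ℬ γ)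
    (Q : GradedProj ℬ)
    (hQ : ∃ (ι : Type) (_ : Fintype ι),
      Nonempty (DualBasis A ι (unitalPart h.hasLocalUnits f Q.carrier))) : GradedProj 𝒜 where
  carrier := unitalPart h.hasLocalUnits f Q.carrier
  deg γ := (Q.deg γ).comap (unitalPart h.hasLocalUnits f Q.carrier).subtype
  isGrading := Q.isGrading_unitalPart f h hf
  smul_mem := by
    intro γ μ p a hp ha
    change op (ZUnit.map f (ZUnit.inr a)) • p.1 ∈ Q.deg (γ + μ)
    rw [ZUnit.map_inr]
    exact Q.smul_mem hp (hf _ a ha)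
  finite := by
    obtain ⟨ι, _, ⟨D⟩⟩ := hQ
    exact D.finite
  projective := by
    obtain ⟨ι, _, ⟨D⟩⟩ := hQ
    exact D.projective
  unital := by
    obtain ⟨ι, _, ⟨D⟩⟩ := hQ
    exact D.unital

end GradedProj

end Restriction

/-! ### Functoriality of the extension of scalars -/

section Extension

variable {Γ : Type v} [AddCommGroup Γ] {A B : Type u} [NonUnitalRing A] [NonUnitalRing B]
  {𝒜 : Γ → AddSubgroup A} {ℬ : Γ → AddSubgroup B} [IsRingGrading 𝒜] [IsRingGrading ℬ]

/-- Balanced biadditive maps that are linear in `S` factor linearly through `P ⊗_R S`. -/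
theorem ScalarExt.exists_linear_lift {R S : Type*} [Ring R] [Ring S] (f : R →+* S) {P N : Type*}
    [AddCommGroup P] [Module Rᵐᵒᵖ P] [AddCommGroup N] [Module Sᵐᵒᵖ N] (g : P →+ N)
    (hg : ∀ r p, g (op r • p) = op (f r) • g p) :
    ∃ l : ScalarExt f P →ₗ[Sᵐᵒᵖ] N, ∀ p s, l (tmul f p s) = op s • g p := by
  obtain ⟨l, hl⟩ := ScalarExt.exists_lift f (P := P) (N := N)
    (AddMonoidHom.mk' (fun s => AddMonoidHom.mk' (fun p => op s • g p) (by simp))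
      (fun s t => by ext p : 1; simp [add_smul]))
    (fun r s p => by
      change op (f r * s) • g p = op s • g (op r • p)
      rw [hg, op_mul, mul_smul])
  have hl : ∀ p s, l (tmul f p s) = op s • g p := hl
  refine ⟨{ toFun := l, map_add' := map_add l, map_smul' := fun t x => ?_ }, hl⟩
  rw [RingHom.id_apply, ← op_unop t]
  induction x using ScalarExt.induction with
  | add x y hx hy => rw [smul_add, map_add, map_add, smul_add, hx, hy]
  | tmul p s => rw [smul_tmul, hl, hl, op_mul, mul_smul]

theorem map_mem_of_mem_extGrading {R S : Type*} [Ring R] [Ring S] (f : R →+* S) {P N : Type*}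
    [AddCommGroup P] [Module Rᵐᵒᵖ P] [AddCommGroup N] {𝒮 : Γ → AddSubgroup S}
    {𝓟 : Γ → AddSubgroup P} (𝒩 : Γ → AddSubgroup N) (l : ScalarExt f P →+ N)
    (hl : ∀ α β, ∀ p ∈ 𝓟 α, ∀ s ∈ 𝒮 β, l (ScalarExt.tmul f p s) ∈ 𝒩 (α + β)) {γ : Γ}
    {x : ScalarExt f P} (hx : x ∈ extGrading f 𝒮 𝓟 γ) : l x ∈ 𝒩 γ := by
  induction hx using AddSubgroup.closure_induction with
  | mem x hx =>
    obtain ⟨α, β, rfl, p, hp, s, hs, rfl⟩ := hx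
    exact hl α β p hp s hs
  | zero => rw [map_zero]; exact zero_mem _
  | add x y _ _ hx hy => rw [map_add]; exact add_mem hx hy
  | neg x _ hx => rw [map_neg]; exact neg_mem hx

theorem GradedProj.Iso.extend (f : A →ₙ+* B) (hf : ∀ γ, ∀ a ∈ 𝒜 γ, f a ∈ ℬ γ)
    {P Q : GradedProj 𝒜} (h : P.Iso Q) : (P.extend f hf).Iso (Q.extend (ℬ := ℬ) f hf) := by
  obtain ⟨e, he⟩ := h
  -- Stated for an arbitrary equivalence, so that `e` and `e.symm` yield mutually inverse maps.
  have key : ∀ {P Q : GradedProj 𝒜} (e : P.carrier ≃ₗ[(ZUnit A)ᵐᵒᵖ] Q.carrier),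
      ∃ l : ScalarExt (ZUnit.map f) P.carrier →ₗ[(ZUnit B)ᵐᵒᵖ]
        ScalarExt (ZUnit.map f) Q.carrier,
        ∀ p s, l (ScalarExt.tmul _ p s) = ScalarExt.tmul _ (e p) s := by
    intro P Q e
    obtain ⟨l, hl⟩ := ScalarExt.exists_linear_lift (ZUnit.map f)
      (N := ScalarExt (ZUnit.map f) Q.carrier)
      (AddMonoidHom.mk' (fun p : P.carrier => ScalarExt.tmul (ZUnit.map f) (e p) 1)
        fun p q => by rw [map_add, ScalarExt.add_tmul])
      fun r p => by
        simp only [AddMonoidHom.mk'_apply, map_smul, ScalarExt.tmul_smul, ScalarExt.smul_tmul,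
          mul_one, one_mul]
    exact ⟨l, fun p s => by rw [hl, AddMonoidHom.mk'_apply, ScalarExt.smul_tmul, one_mul]⟩
  obtain ⟨l, hl⟩ := key e
  obtain ⟨m, hm⟩ := key e.symm
  have hl_bij : Function.Bijective l := by
    refine Function.bijective_iff_has_inverse.2 ⟨m, fun x => ?_, fun x => ?_⟩
    · induction x using ScalarExt.induction with
      | add x y hx hy => rw [map_add, map_add, hx, hy]
      | tmul p s => rw [hl, hm, e.symm_apply_apply]
    · induction x using ScalarExt.induction with
      | add x y hx hy => rw [map_add, map_add, hx, hy]
      | tmul p s => rw [hm, hl, e.apply_symm_apply]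
  refine GradedProj.Iso.of_bijective l hl_bij fun γ x hx =>
    map_mem_of_mem_extGrading (ZUnit.map f)
      (extGrading (ZUnit.map f) (ZUnit.grading ℬ) Q.deg) l.toAddMonoidHom
      (fun α β p hp s hs => ?_) hx
  rw [LinearMap.toAddMonoidHom_coe, hl]
  exact AddSubgroup.subset_closure ⟨α, β, rfl, e p, (he α p).2 hp, s, hs, rfl⟩

end Extension

/-! ### Functoriality of the graded Grothendieck group -/

section K0

variable {Γ : Type v} [AddCommGroup Γ] {A B : Type u} [NonUnitalRing A] [NonUnitalRing B]
  {𝒜 : Γ → AddSubgroup A} {ℬ : Γ → AddSubgroup B}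

namespace GrK0

theorem addHom_ext {G : Type*} [AddCommGroup G] {f g : GrK0 𝒜 →+ G}
    (h : ∀ x, f (of x) = g (of x)) : f = g :=
  (Algebra.GrothendieckAddGroup.lift (M := GrV 𝒜) (G := G)).symm.injective
    (AddMonoidHom.ext h)

theorem single_smul (γ : Γ) (n : ℤ) (x : GrK0 𝒜) :
    (AddMonoidAlgebra.single γ n : AddMonoidAlgebra ℤ Γ) • x = n • shift γ x := by
  change AddMonoidAlgebra.lift ℤ (AddMonoid.End (GrK0 𝒜)) Γ (shiftHom 𝒜) _ x = _
  rw [AddMonoidAlgebra.lift_single]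
  rfl

/-- The homomorphism induced by a homomorphism `𝒱^gr(A) → 𝒱^gr(B)`. -/
noncomputable def map (g : GrV 𝒜 →+ GrV ℬ) : GrK0 𝒜 →+ GrK0 ℬ :=
  Algebra.GrothendieckAddGroup.lift (of.comp g)

theorem map_of (g : GrV 𝒜 →+ GrV ℬ) (x : GrV 𝒜) : map g (of x) = of (g x) :=
  DFunLike.congr_fun (Algebra.GrothendieckAddGroup.lift.symm_apply_apply (of.comp g)) x

/-- The isomorphism of `ℤ[Γ]`-modules induced by an isomorphism `𝒱^gr(A) ≃ 𝒱^gr(B)` that commutes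
with the action of `Γ`. -/
noncomputable def congr (e : GrV 𝒜 ≃+ GrV ℬ)
    (he : ∀ γ x, e (GrV.shift γ x) = GrV.shift γ (e x)) :
    GrK0 𝒜 ≃ₗ[AddMonoidAlgebra ℤ Γ] GrK0 ℬ where
  __ := map e.toAddMonoidHom
  invFun := map e.symm.toAddMonoidHom
  left_inv x := by
    have : (map e.symm.toAddMonoidHom).comp (map e.toAddMonoidHom) = AddMonoidHom.id _ :=
      addHom_ext fun x => by
        rw [AddMonoidHom.comp_apply, map_of, map_of]
        exact congrArg of (e.symm_apply_apply x)
    exact DFunLike.congr_fun this x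
  right_inv x := by
    have : (map e.toAddMonoidHom).comp (map e.symm.toAddMonoidHom) = AddMonoidHom.id _ :=
      addHom_ext fun x => by
        rw [AddMonoidHom.comp_apply, map_of, map_of]
        exact congrArg of (e.apply_symm_apply x)
    exact DFunLike.congr_fun this x
  map_smul' r x := by
    change map e.toAddMonoidHom (r • x) = r • map e.toAddMonoidHom x
    have hshift : ∀ γ x, map e.toAddMonoidHom (shift γ x) = shift γ (map e.toAddMonoidHom x) := by
      intro γ x
      have : (map e.toAddMonoidHom).comp (shift γ) = (shift γ).comp (map e.toAddMonoidHom) :=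
        addHom_ext fun x => by
          rw [AddMonoidHom.comp_apply, AddMonoidHom.comp_apply, map_of, shift_of, shift_of, map_of]
          exact congrArg of (he γ x)
      exact DFunLike.congr_fun this x
    induction r using AddMonoidAlgebra.induction_linear with
    | zero => rw [zero_smul, zero_smul, map_zero]
    | add r s hr hs => rw [add_smul, add_smul, map_add, hr, hs]
    | single γ n => rw [single_smul, single_smul, map_zsmul, hshift]

theorem congr_of (e : GrV 𝒜 ≃+ GrV ℬ) (he : ∀ γ x, e (GrV.shift γ x) = GrV.shift γ (e x))
    (x : GrV 𝒜) : congr e he (of x) = of (e x) := map_of _ x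

/-- A positive difference is the class of an element v of the monoid; it is carried over by e in one
direction and pulled back by `e.symm` in the other. -/
theorem congr_le_congr_iff (e : GrV 𝒜 ≃+ GrV ℬ)
    (he : ∀ γ x, e (GrV.shift γ x) = GrV.shift γ (e x)) (x y : GrK0 𝒜) :
    congr e he x ≤ congr e he y ↔ x ≤ y := by
  constructor
  · rintro ⟨v, hv⟩
    refine ⟨e.symm v, (congr e he).injective ?_⟩
    rw [hv, map_add, congr_of, e.apply_symm_apply]
  · rintro ⟨v, rfl⟩
    exact ⟨e v, by rw [map_add, congr_of]⟩

end GrK0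

end K0

/-! ### Computations in `M_∞(A)` -/

section MatInf

variable {A : Type u} [NonUnitalRing A]

namespace MatInf

theorem unit_mul_unit_same (i j l : ℕ) (a b : A) :
    unit i j a * unit j l b = unit i l (a * b) := by
  rw [unit_mul_unit, if_pos rfl]

theorem corner_apply (a : A) : corner A a = unit 0 0 a := rfl

/-- The element c is a m_{jk} b; only its existence is needed. With i = l = 0 it says that such a
product falls into the corner, so that it can be moved across a tensor product over `A`. -/
theorem exists_unit_mul_mul_unit (i j k l : ℕ) (a b : A) (m : MatInf A) :
    ∃ c, unit i j a * m * unit k l b = unit i l c := by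
  induction m using MatInf.induction with
  | add x y hx hy =>
    obtain ⟨c, hc⟩ := hx
    obtain ⟨d, hd⟩ := hy
    exact ⟨c + d, by rw [mul_add, add_mul, hc, hd, map_add]⟩
  | unit p q x =>
    rw [unit_mul_unit]
    split_ifs
    · rw [unit_mul_unit]
      split_ifs
      · exact ⟨_, rfl⟩
      · exact ⟨0, (map_zero _).symm⟩
    · exact ⟨0, by rw [zero_mul, map_zero]⟩

/-- The integer part n of s contributes n times the product of the two outer matrices, which sits in
the same position (i, l). -/
theorem exists_inr_unit_mul_mul_inr_unit (i j k l : ℕ) (a b : A) (s : ZUnit (MatInf A)) :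
    ∃ c, ZUnit.inr (unit i j a) * s * ZUnit.inr (unit k l b) = ZUnit.inr (unit i l c) := by
  obtain ⟨c, hc⟩ := exists_unit_mul_mul_unit i j k l a b (ZUnit.snd s)
  have hn : ∃ d, unit i j a * unit k l b = unit i l d := by
    rw [unit_mul_unit]
    split_ifs
    · exact ⟨_, rfl⟩
    · exact ⟨0, (map_zero _).symm⟩
  obtain ⟨d, hd⟩ := hn
  refine ⟨ZUnit.fst s • d + c, ?_⟩
  ext1
  · simp
  · simp [add_mul, smul_mul_assoc, hc, hd]

theorem corner_mul_apply (a : A) (m : MatInf A) (j : ℕ) :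
    (corner A a * m) (0, j) = a * m (0, j) := by
  rw [mul_apply, finsum_eq_single _ 0]
  · rw [corner_apply, unit_apply, if_pos rfl]
  · intro k hk
    rw [corner_apply, unit_apply, if_neg (by simpa using hk.symm), zero_mul]

theorem mul_corner_apply (m : MatInf A) (a : A) (i : ℕ) :
    (m * corner A a) (i, 0) = m (i, 0) * a := by
  rw [mul_apply, finsum_eq_single _ 0]
  · rw [corner_apply, unit_apply, if_pos rfl]
  · intro k hk
    rw [corner_apply, unit_apply, if_neg (by simpa using hk.symm), mul_zero]

/-- The entry in position `p`. -/
def entry (p : ℕ × ℕ) : MatInf A →+ A where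
  toFun m := m p
  map_zero' := rfl
  map_add' _ _ := rfl

theorem entry_apply (p : ℕ × ℕ) (m : MatInf A) : entry p m = m p := rfl

/-- The matrix m ι(a) lives in the first column, so its k-th row has the single entry (k, 0), which
can be factored out through the corner. -/
theorem unit_mul_mul_corner (k : ℕ) (f a : A) (m : MatInf A) :
    unit k k f * (m * corner A a) = unit k 0 f * corner A ((m * corner A a) (k, 0)) := by
  rw [mul_corner_apply, corner_apply, corner_apply, unit_mul_unit_same]
  induction m using MatInf.induction with
  | add x y hx hy => rw [add_mul, mul_add, hx, hy, add_apply, add_mul, mul_add, map_add]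
  | unit i j b =>
    rw [unit_mul_unit, unit_apply]
    by_cases hj : j = 0
    · subst hj
      rw [if_pos rfl, unit_mul_unit]
      by_cases hi : k = i
      · subst hi; simp
      · rw [if_neg hi, if_neg (by simpa using Ne.symm hi), zero_mul, mul_zero, map_zero]
    · rw [if_neg hj, if_neg (by simp [hj]), zero_mul, mul_zero, mul_zero, map_zero]

/-- The map `ℤ ⊕ M_∞(A) → ℤ ⊕ A` that takes the `(0, 0)` entry. -/
noncomputable def zunitEntry : ZUnit (MatInf A) →+ ZUnit A :=
  (Int.castRingHom (ZUnit A)).toAddMonoidHom.comp ZUnit.fst.toAddMonoidHom +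
    (AddMonoidHomClass.toAddMonoidHom (ZUnit.inr (A := A))).comp ((entry (0, 0)).comp ZUnit.snd)

theorem zunitEntry_apply (s : ZUnit (MatInf A)) :
    zunitEntry s = (ZUnit.fst s : ZUnit A) + ZUnit.inr (ZUnit.snd s (0, 0)) := rfl

theorem zunitEntry_one : zunitEntry (1 : ZUnit (MatInf A)) = 1 := by
  rw [zunitEntry_apply]
  ext <;> simp

/-- `zunitEntry` is not multiplicative, but it is left linear over ℤ ⊕ A. That is exactly what makes
(p, s) ↦ p·`zunitEntry s` balanced, and so defined on P ⊗_A M. -/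
theorem zunitEntry_map_corner_mul (r : ZUnit A) (s : ZUnit (MatInf A)) :
    zunitEntry (ZUnit.map (corner A) r * s) = r * zunitEntry s := by
  simp only [zunitEntry_apply, ZUnit.snd_mul, ← entry_apply, map_add, map_zsmul]
  simp only [entry_apply, ZUnit.snd_map, corner_mul_apply]
  ext
  · simp
  · simp [corner_apply, unit_apply, mul_add]
    abel

/-- The diagonal matrix with `N` entries `f`. -/
noncomputable def diag (N : ℕ) (f : A) : MatInf A := ∑ k ∈ Finset.range N, unit k k f

theorem diag_mul_unit {N i : ℕ} (hi : i < N) (j : ℕ) (f a : A) :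
    diag N f * unit i j a = unit i j (f * a) := by
  rw [diag, Finset.sum_mul, Finset.sum_eq_single_of_mem i (Finset.mem_range.2 hi)]
  · rw [unit_mul_unit_same]
  · intro k _ hk
    rw [unit_mul_unit, if_neg hk]

theorem unit_mul_diag {N j : ℕ} (hj : j < N) (i : ℕ) (f a : A) :
    unit i j a * diag N f = unit i j (a * f) := by
  rw [diag, Finset.mul_sum, Finset.sum_eq_single_of_mem j (Finset.mem_range.2 hj)]
  · rw [unit_mul_unit_same]
  · intro k _ hk
    rw [unit_mul_unit, if_neg hk.symm]

/-- Finitely many matrices have a common unit of the form `diag N f`. -/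
theorem exists_diag (h : HasLocalUnits A) (s : Finset (MatInf A)) :
    ∃ N f, ∀ m ∈ s, diag N f * m = m ∧ m * diag N f = m := by
  classical
  -- The statement holds for every large N and every f that is a unit on t, so that the conditions
  -- for several matrices can be met at once.
  have h1 : ∀ m : MatInf A, ∃ (t : Finset A) (n : ℕ), ∀ N f,
      (∀ a ∈ t, f * a = a ∧ a * f = a) → n ≤ N → diag N f * m = m ∧ m * diag N f = m := by
    intro m
    induction m using MatInf.induction with
    | unit i j a =>
      -- `diag N f` occupies the positions 0, …, N - 1, so both i and j must be less than N.
      refine ⟨{a}, max i j + 1, fun N f hf hN => ?_⟩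
      have hi : i < N := by omega
      have hj : j < N := by omega
      obtain ⟨hl, hr⟩ := hf a (Finset.mem_singleton_self a)
      rw [diag_mul_unit hi, unit_mul_diag hj, hl, hr]
      exact ⟨rfl, rfl⟩
    | add x y hx hy =>
      obtain ⟨t, n, hx⟩ := hx
      obtain ⟨t', n', hy⟩ := hy
      refine ⟨t ∪ t', max n n', fun N f hf hN => ?_⟩
      obtain ⟨hx1, hx2⟩ := hx N f (fun a ha => hf a (Finset.mem_union_left _ ha)) (by omega)
      obtain ⟨hy1, hy2⟩ := hy N f (fun a ha => hf a (Finset.mem_union_right _ ha)) (by omega)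
      rw [mul_add, add_mul, hx1, hx2, hy1, hy2]
      exact ⟨rfl, rfl⟩
  choose t n htn using h1
  obtain ⟨f, hf⟩ := h (s.biUnion t)
  exact ⟨s.sup n, f, fun m hm => htn m _ f
    (fun a ha => hf a (Finset.mem_biUnion.2 ⟨m, hm, ha⟩)) (Finset.le_sup hm)⟩

theorem hasLocalUnits (h : HasLocalUnits A) : HasLocalUnits (MatInf A) := fun s => by
  obtain ⟨N, f, hf⟩ := exists_diag h s
  exact ⟨_, hf⟩

theorem exists_diag_module (h : HasLocalUnits A) {P : Type*} [AddCommGroup P]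
    [Module (ZUnit (MatInf A))ᵐᵒᵖ P]
    (hP : ∀ p : P, p ∈ AddSubgroup.closure
      {x | ∃ (q : P) (a : MatInf A), x = op (ZUnit.inr a) • q})
    (s : Finset P) : ∃ (N : ℕ) (f : A), ∀ p ∈ s, op (ZUnit.inr (diag N f)) • p = p := by
  obtain ⟨b, hb⟩ := (hasLocalUnits h).exists_unit_module hP s
  obtain ⟨N, f, hf⟩ := exists_diag h {b}
  refine ⟨N, f, fun p hp => ?_⟩
  conv_lhs => rw [← hb p hp]
  rw [smul_smul, ← op_mul, ← map_mul, (hf b (Finset.mem_singleton_self b)).2, hb p hp]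

end MatInf

end MatInf

/-! ### Restriction to the corner -/

section Corner

variable {A : Type u} [NonUnitalRing A]

open MatInf

/-- Let g_i, φ_i be a dual basis of Q over M and let `diag N f` fix all g_i. For q in Q ι(A), each
φ_i(q) is supported in its first column, and inserting `diag N f` gives q = Σ_i g_i·diag(f)·φ_i(q) =
Σ_{i,k} (g_i·f E_{k0})·ι(φ_i(q)_{k0}). Hence the elements g_i·f E_{k0} and the functionals q ↦
φ_i(q)_{k0} form a dual basis over `A`. -/
theorem exists_dualBasis_unitalPart (h : HasLocalUnits A) {Q : Type w} [AddCommGroup Q]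
    [Module (ZUnit (MatInf A))ᵐᵒᵖ Q] [Module.Finite (ZUnit (MatInf A))ᵐᵒᵖ Q]
    [Module.Projective (ZUnit (MatInf A))ᵐᵒᵖ Q]
    (hQ : ∀ q : Q, q ∈ AddSubgroup.closure
      {x | ∃ (p : Q) (a : MatInf A), x = op (ZUnit.inr a) • p}) :
    ∃ (ι : Type) (_ : Fintype ι), Nonempty (DualBasis A ι (unitalPart h (corner A) Q)) := by
  classical
  obtain ⟨n, ⟨D⟩⟩ := exists_dualBasis (hasLocalUnits h) hQ
  obtain ⟨N, f, hf⟩ := exists_diag_module h hQ (Finset.univ.image D.gen)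
  -- Since fg = f, the new generators g_i·f E_{k0} are fixed by ι(g), and so lie in Q ι(A).
  obtain ⟨g, -, hg⟩ := h.exists_unit f
  have hcoord : ∀ i (r : ZUnit A) (q : Q), D.coord i (op (ZUnit.map (corner A) r) • q) =
      ZUnit.fst r • D.coord i q + D.coord i q * corner A (ZUnit.snd r) := by
    intro i r q
    have := congrArg ZUnit.snd (D.coord_smul i (op (ZUnit.map (corner A) r)) q)
    simpa using this
  refine ⟨Fin n × Fin N, inferInstance, ⟨⟨fun x => ⟨op (ZUnit.inr (unit x.2 0 f)) • D.gen x.1,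
    smul_mem_unitalPart_of_mul_eq h (corner A)
      (by rw [corner_apply, unit_mul_unit_same, hg]) _⟩,
    fun x => ((entry (x.2, 0)).comp (D.coord x.1)).comp (unitalPart h (corner A) Q).subtype,
    ?_, ?_⟩⟩⟩
  · rintro ⟨i, k⟩ r q
    change ZUnit.inr (D.coord i (op (ZUnit.map (corner A) r.unop) • q.1) (k, 0)) =
      ZUnit.inr (D.coord i q.1 (k, 0)) * r.unop
    rw [hcoord, ← entry_apply, map_add, map_zsmul, entry_apply, entry_apply, mul_corner_apply]
    ext <;> simp
  · rintro ⟨q, a, ha⟩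
    refine Subtype.ext ?_
    have hq : ∀ i, D.coord i q = D.coord i q * corner A a := by
      intro i
      have := hcoord i (ZUnit.inr a) q
      rw [ZUnit.map_inr, ha] at this
      simpa using this
    rw [AddSubgroup.val_finsetSum, Fintype.sum_prod_type]
    refine Eq.trans ?_ (D.sum_eq q)
    refine Finset.sum_congr rfl fun i _ => ?_
    conv_rhs => rw [← hf _ (Finset.mem_image_of_mem D.gen (Finset.mem_univ i)), smul_smul,
      ← op_mul, ← map_mul, diag, Finset.sum_mul, ← Fin.sum_univ_eq_sum_range
        (fun k => unit k k f * D.coord i q), map_sum, Finset.op_sum, Finset.sum_smul]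
    refine Finset.sum_congr rfl fun k _ => ?_
    change op (ZUnit.map (corner A) (ZUnit.inr (D.coord i q (k, 0)))) •
      op (ZUnit.inr (unit k 0 f)) • D.gen i = _
    rw [smul_smul, ← op_mul, ZUnit.map_inr, ← map_mul]
    conv_rhs => rw [hq i, unit_mul_mul_corner, ← hq i]

variable {Γ : Type v} [AddCommGroup Γ] {𝒜 : Γ → AddSubgroup A} {δ : ℕ → Γ}

namespace GradedProj

theorem smul_mem_of_mem_grading {P : GradedProj 𝒜} {γ μ : Γ} {p : P.carrier} {s : ZUnit A}
    (hp : p ∈ P.deg γ) (hs : s ∈ ZUnit.grading 𝒜 μ) : op s • p ∈ P.deg (γ + μ) := by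
  obtain ⟨hs, hs'⟩ := hs
  rw [ZUnit.eq_add s, op_add, add_smul]
  refine add_mem ?_ (P.smul_mem hp hs)
  by_cases hμ : μ = 0
  · subst hμ
    rw [op_intCast, Int.cast_smul_eq_zsmul, add_zero]
    exact zsmul_mem hp _
  · rw [hs' hμ, Int.cast_zero, op_zero, zero_smul]
    exact zero_mem _

/-- The graded right `A`-module `Q ι(A)`, for a graded right `M_∞(A)(δ)`-module `Q`. -/
noncomputable def restrictCorner (h : HasGradedLocalUnits 𝒜) (Q : GradedProj (MatInf.grading 𝒜 δ)) :
    GradedProj 𝒜 :=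
  Q.restrict h (corner A) (corner_mem 𝒜 δ) (exists_dualBasis_unitalPart h.hasLocalUnits Q.unital)

theorem Iso.restrictCorner (h : HasGradedLocalUnits 𝒜) {P Q : GradedProj (MatInf.grading 𝒜 δ)}
    (hPQ : P.Iso Q) : (P.restrictCorner h).Iso (Q.restrictCorner h) := by
  obtain ⟨e, he⟩ := hPQ
  have hmem : ∀ {P Q : GradedProj (MatInf.grading 𝒜 δ)}
      (e : P.carrier ≃ₗ[(ZUnit (MatInf A))ᵐᵒᵖ] Q.carrier) {p : P.carrier},
      p ∈ unitalPart h.hasLocalUnits (corner A) P.carrier →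
      e p ∈ unitalPart h.hasLocalUnits (corner A) Q.carrier := by
    rintro P Q e p ⟨a, ha⟩
    exact ⟨a, by rw [← map_smul, ha]⟩
  let e' : unitalPart h.hasLocalUnits (corner A) P.carrier ≃ₗ[(ZUnit A)ᵐᵒᵖ]
      unitalPart h.hasLocalUnits (corner A) Q.carrier :=
    { toFun := fun p => ⟨e p.1, hmem e p.2⟩
      map_add' := fun p q => Subtype.ext (map_add e _ _)
      map_smul' := fun r p => Subtype.ext (map_smul e _ _)
      invFun := fun q => ⟨e.symm q.1, hmem e.symm q.2⟩
      left_inv := fun p => Subtype.ext (e.symm_apply_apply _)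
      right_inv := fun q => Subtype.ext (e.apply_symm_apply _) }
  exact ⟨e', fun γ p => he γ p.1⟩

theorem zero_restrictCorner_iso (h : HasGradedLocalUnits 𝒜) :
    ((zero (MatInf.grading 𝒜 δ)).restrictCorner h).Iso (zero 𝒜) := by
  let e : unitalPart h.hasLocalUnits (corner A) (zero (MatInf.grading 𝒜 δ)).carrier
      ≃ₗ[(ZUnit A)ᵐᵒᵖ] (zero 𝒜).carrier :=
    { toFun := fun _ => 0
      map_add' := fun _ _ => (add_zero _).symm
      map_smul' := fun _ _ => (smul_zero _).symm
      invFun := fun _ => 0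
      left_inv := fun _ => Subtype.ext (Subsingleton.elim (α := PUnit) _ _)
      right_inv := fun _ => Subsingleton.elim (α := PUnit) _ _ }
  exact ⟨e, fun γ p => ⟨fun _ => Subsingleton.elim (α := PUnit) _ _, fun _ => zero_mem _⟩⟩

theorem sum_restrictCorner_iso (h : HasGradedLocalUnits 𝒜)
    (P Q : GradedProj (MatInf.grading 𝒜 δ)) :
    ((P.sum Q).restrictCorner h).Iso ((P.restrictCorner h).sum (Q.restrictCorner h)) := by
  have hfst : ∀ x : P.carrier × Q.carrier,
      x ∈ unitalPart h.hasLocalUnits (corner A) (P.carrier × Q.carrier) →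
      x.1 ∈ unitalPart h.hasLocalUnits (corner A) P.carrier :=
    fun x ⟨a, ha⟩ => ⟨a, congrArg Prod.fst ha⟩
  have hsnd : ∀ x : P.carrier × Q.carrier,
      x ∈ unitalPart h.hasLocalUnits (corner A) (P.carrier × Q.carrier) →
      x.2 ∈ unitalPart h.hasLocalUnits (corner A) Q.carrier :=
    fun x ⟨a, ha⟩ => ⟨a, congrArg Prod.snd ha⟩
  -- The coordinates may be fixed by different elements of `A`, so (x, y) is treated as the sum (x,
  -- 0) + (0, y).
  have hpair : ∀ x ∈ unitalPart h.hasLocalUnits (corner A) P.carrier,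
      ∀ y ∈ unitalPart h.hasLocalUnits (corner A) Q.carrier,
      (x, y) ∈ unitalPart h.hasLocalUnits (corner A) (P.carrier × Q.carrier) := by
    rintro x ⟨a, ha⟩ y ⟨b, hb⟩
    have hx : (x, (0 : Q.carrier)) ∈
        unitalPart h.hasLocalUnits (corner A) (P.carrier × Q.carrier) :=
      ⟨a, Prod.ext ha (smul_zero _)⟩
    have hy : ((0 : P.carrier), y) ∈
        unitalPart h.hasLocalUnits (corner A) (P.carrier × Q.carrier) :=
      ⟨b, Prod.ext (smul_zero _) hb⟩
    simpa using add_mem hx hy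
  let e : unitalPart h.hasLocalUnits (corner A) (P.carrier × Q.carrier) ≃ₗ[(ZUnit A)ᵐᵒᵖ]
      unitalPart h.hasLocalUnits (corner A) P.carrier ×
        unitalPart h.hasLocalUnits (corner A) Q.carrier :=
    { toFun := fun x => (⟨x.1.1, hfst _ x.2⟩, ⟨x.1.2, hsnd _ x.2⟩)
      map_add' := fun _ _ => rfl
      map_smul' := fun _ _ => rfl
      invFun := fun x => ⟨(x.1.1, x.2.1), hpair _ x.1.2 _ x.2.2⟩
      left_inv := fun _ => rfl
      right_inv := fun _ => rfl }
  exact ⟨e, fun γ p => Iff.rfl⟩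

variable [IsRingGrading 𝒜]

/-- Multiplication `(Q ι(A)) ⊗_A M_∞(A) → Q` is an isomorphism. -/
theorem extend_restrictCorner_iso (h : HasGradedLocalUnits 𝒜)
    (Q : GradedProj (MatInf.grading 𝒜 δ)) :
    ((Q.restrictCorner h).extend (corner A) (corner_mem 𝒜 δ)).Iso Q := by
  have h' := h.hasLocalUnits
  let R := unitalPart h' (corner A) Q.carrier
  let F := ZUnit.map (corner A)
  obtain ⟨l, hl⟩ := ScalarExt.exists_linear_lift F R.subtype fun r p => rfl
  have hunital := ((Q.restrictCorner h).extend (corner A) (corner_mem 𝒜 δ)).unital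
  have hinj : Function.Injective l := by
    rw [injective_iff_map_eq_zero]
    intro x hx
    obtain ⟨N, f, hf⟩ := exists_diag_module (P := ScalarExt F R) h' hunital {x}
    obtain ⟨g, -, hg⟩ := h'.exists_unit f
    -- The map θ(q) = Σ_k (q·f E_{k0}) ⊗ g E_{0k} is an inverse of l near x: since fg = f, the
    -- composite θ ∘ l is multiplication by `diag N f`, which fixes x. It depends on x, as no single
    -- diagonal matrix need serve for all elements.
    let θ : Q.carrier →+ ScalarExt F R := ∑ k ∈ Finset.range N, AddMonoidHom.mk'
      (fun q => ScalarExt.tmul F (⟨op (ZUnit.inr (unit k 0 f)) • q,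
        smul_mem_unitalPart_of_mul_eq h' (corner A)
          (by rw [corner_apply, unit_mul_unit_same, hg]) q⟩ : R) (ZUnit.inr (unit 0 k g)))
      fun p q => by
        rw [← ScalarExt.add_tmul]
        congr 1
        exact Subtype.ext (smul_add _ _ _)
    have hθ : ∀ x, θ (l x) = op (ZUnit.inr (diag N f)) • x := by
      intro x
      induction x using ScalarExt.induction with
      | add x y hx hy => rw [map_add, map_add, smul_add, hx, hy]
      | tmul q s =>
        obtain ⟨a, ha⟩ := q.2
        have hq : op (ZUnit.inr a) • q = q := Subtype.ext (by
          rw [coe_smul_unitalPart, unop_op, ZUnit.map_inr, ha])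
        rw [hl, ScalarExt.smul_tmul, diag, map_sum, Finset.mul_sum]
        simp only [θ, AddMonoidHom.finsetSum_apply, AddMonoidHom.mk'_apply]
        have htmul : ∀ t : ℕ → ZUnit (MatInf A),
            ScalarExt.tmul F q (∑ k ∈ Finset.range N, t k) =
              ∑ k ∈ Finset.range N, ScalarExt.tmul F q (t k) := fun t =>
          map_sum (AddMonoidHom.mk' (ScalarExt.tmul F q) (ScalarExt.tmul_add F q)) t _
        rw [htmul]
        refine Finset.sum_congr rfl fun k _ => ?_
        -- Writing q = q·a brackets s between ι(a) and f E_{k0}, so q·s·f E_{k0} = q·c with c in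
        -- `A`. Then c crosses the tensor sign, and ι(c) g E_{0k} = ι(a) s f E_{kk}.
        obtain ⟨c, hc⟩ := exists_inr_unit_mul_mul_inr_unit 0 0 k 0 a f s
        have hqc : (⟨op (ZUnit.inr (unit k 0 f)) • op s • R.subtype q,
            smul_mem_unitalPart_of_mul_eq h' (corner A)
              (by rw [corner_apply, unit_mul_unit_same, hg]) _⟩ : R) = op (ZUnit.inr c) • q := by
          refine Subtype.ext ?_
          rw [coe_smul_unitalPart, unop_op, ZUnit.map_inr]
          change op _ • op s • q.1 = _
          rw [corner_apply, ← hc]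
          conv_lhs => rw [← ha]
          simp only [smul_smul, ← op_mul, mul_assoc, corner_apply]
        rw [hqc, ScalarExt.tmul_smul]
        conv_rhs => rw [← hq, ScalarExt.tmul_smul]
        congr 1
        simp only [F, ZUnit.map_inr, corner_apply]
        rw [← hc, mul_assoc, mul_assoc, ← map_mul, unit_mul_unit_same, hg]
    rw [← hf x (Finset.mem_singleton_self x), ← hθ, hx, map_zero]
  have hsurj : Function.Surjective l := by
    intro q
    change q ∈ l.toAddMonoidHom.range
    refine (AddSubgroup.closure_le _).2 ?_ (Q.unital q)
    rintro _ ⟨q, m, rfl⟩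
    change op (ZUnit.inr m) • q ∈ l.toAddMonoidHom.range
    induction m using MatInf.induction with
    | add x y hx hy => rw [map_add, op_add, add_smul]; exact add_mem hx hy
    | unit i j a =>
      -- Fullness of the corner: a E_{ij} = (e E_{i0})(a E_{0j}) because ea = a. The element g, with
      -- eg = e, shows that q·e E_{i0} lies in Q ι(A).
      obtain ⟨e, hea, -⟩ := h'.exists_unit a
      obtain ⟨g, -, hge⟩ := h'.exists_unit e
      refine ⟨ScalarExt.tmul F (⟨op (ZUnit.inr (unit i 0 e)) • q,
        smul_mem_unitalPart_of_mul_eq h' (corner A)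
          (by rw [corner_apply, unit_mul_unit_same, hge]) q⟩ : R) (ZUnit.inr (unit 0 j a)), ?_⟩
      rw [LinearMap.toAddMonoidHom_coe, hl]
      change op (ZUnit.inr (unit 0 j a)) • op (ZUnit.inr (unit i 0 e)) • q = _
      rw [smul_smul, ← op_mul, ← map_mul, unit_mul_unit_same, hea]
  refine Iso.of_bijective l ⟨hinj, hsurj⟩ fun γ x hx =>
    map_mem_of_mem_extGrading F Q.deg l.toAddMonoidHom (fun α β p hp s hs => ?_) hx
  rw [LinearMap.toAddMonoidHom_coe, hl]
  exact smul_mem_of_mem_grading hp hs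

/-- `p ↦ p ⊗ 1` is an isomorphism of `P` onto `(P ⊗_A M_∞(A)) ι(A)`. -/
theorem restrictCorner_extend_iso (h : HasGradedLocalUnits 𝒜) (P : GradedProj 𝒜) :
    P.Iso ((P.extend (corner A) (corner_mem 𝒜 δ)).restrictCorner h) := by
  have h' := h.hasLocalUnits
  let F := ZUnit.map (corner A)
  let E := ScalarExt F P.carrier
  have hP : ∀ p : P.carrier, ∃ a : A, op (ZUnit.inr a) • p = p := fun p => by
    obtain ⟨a, ha⟩ := h'.exists_unit_module P.unital {p}
    exact ⟨a, ha p (Finset.mem_singleton_self p)⟩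
  have hmem : ∀ p : P.carrier, ScalarExt.tmul F p 1 ∈ unitalPart h' (corner A) E := by
    intro p
    obtain ⟨a, ha⟩ := hP p
    refine ⟨a, ?_⟩
    conv_rhs => rw [← ha]
    rw [ScalarExt.smul_tmul, ScalarExt.tmul_smul, ZUnit.map_inr, one_mul, mul_one]
  let η : P.carrier →ₗ[(ZUnit A)ᵐᵒᵖ] unitalPart h' (corner A) E :=
    { toFun := fun p => ⟨ScalarExt.tmul F p 1, hmem p⟩
      map_add' := fun p q => Subtype.ext (ScalarExt.add_tmul F p q 1)
      map_smul' := fun r p => Subtype.ext (by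
        change ScalarExt.tmul F (op r.unop • p) 1 = op (F r.unop) • ScalarExt.tmul F p 1
        rw [ScalarExt.tmul_smul, ScalarExt.smul_tmul, mul_one, one_mul]) }
  -- The additive map p ⊗ s ↦ p·`zunitEntry s` sends p ⊗ 1 back to p, which gives injectivity of η.
  obtain ⟨ρ, hρ⟩ := ScalarExt.exists_lift F (P := P.carrier) (N := P.carrier)
    (AddMonoidHom.mk' (fun s => AddMonoidHom.mk' (fun p => op (zunitEntry s) • p) (by simp))
      (fun s t => by ext p : 1; simp [add_smul]))
    (fun r s p => by
      change op (zunitEntry (F r * s)) • p = op (zunitEntry s) • op r • p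
      rw [zunitEntry_map_corner_mul, op_mul, mul_smul])
  have hρ : ∀ p s, ρ (ScalarExt.tmul F p s) = op (zunitEntry s) • p := hρ
  have hinj : Function.Injective η := by
    intro p q hpq
    have := congrArg (fun x => ρ x.1) hpq
    change ρ (ScalarExt.tmul F p 1) = ρ (ScalarExt.tmul F q 1) at this
    rwa [hρ, hρ, zunitEntry_one, op_one, one_smul, one_smul] at this
  have hsurj : Function.Surjective η := by
    rintro ⟨x, a, ha⟩
    -- With p = p·b one has (p ⊗ s)·ι(a) = p ⊗ ι(b) s ι(a) = p ⊗ ι(c) = p·c ⊗ 1, since the middle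
    -- product lies in the corner.
    have key : ∀ x : E, ∃ p, op (ZUnit.inr (corner A a)) • x = ScalarExt.tmul F p 1 := by
      intro x
      induction x using ScalarExt.induction with
      | add x y hx hy =>
        obtain ⟨p, hp⟩ := hx
        obtain ⟨q, hq⟩ := hy
        exact ⟨p + q, by rw [smul_add, hp, hq, ScalarExt.add_tmul]⟩
      | tmul p s =>
        obtain ⟨b, hb⟩ := hP p
        obtain ⟨c, hc⟩ := exists_inr_unit_mul_mul_inr_unit 0 0 0 0 b a s
        refine ⟨op (ZUnit.inr c) • p, ?_⟩
        conv_lhs => rw [← hb]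
        rw [ScalarExt.smul_tmul, ScalarExt.tmul_smul, ScalarExt.tmul_smul, ZUnit.map_inr,
          ZUnit.map_inr, mul_one, ← mul_assoc, corner_apply, corner_apply, corner_apply, hc]
    obtain ⟨p, hp⟩ := key x
    exact ⟨p, Subtype.ext (hp.symm.trans ha)⟩
  refine Iso.of_bijective η ⟨hinj, hsurj⟩ fun γ p hp => ?_
  refine AddSubgroup.subset_closure ⟨γ, 0, add_zero γ, p, hp, 1, ?_, rfl⟩
  exact ⟨by rw [ZUnit.snd_one]; exact zero_mem _, fun h => absurd rfl h⟩

end GradedProj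

end Corner

/-! ### The isomorphism of graded Grothendieck groups -/

section Main

variable {Γ : Type v} [AddCommGroup Γ] {A : Type u} [NonUnitalRing A] {𝒜 : Γ → AddSubgroup A}

/-- The homomorphism `𝒱^gr(M_∞(A)(δ)) → 𝒱^gr(A)`, `[Q] ↦ [Q ι(A)]`. -/
noncomputable def GrV.restrictCorner (h : HasGradedLocalUnits 𝒜) (δ : ℕ → Γ) :
    GrV (MatInf.grading 𝒜 δ) →+ GrV 𝒜 where
  toFun := Quotient.map (GradedProj.restrictCorner h) fun _ _ => GradedProj.Iso.restrictCorner h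
  map_zero' := mk_eq_mk.2 (GradedProj.zero_restrictCorner_iso h)
  map_add' := by
    rintro ⟨P⟩ ⟨Q⟩
    exact mk_eq_mk.2 (GradedProj.sum_restrictCorner_iso h P Q)

/-- Suspension changes only the indexing of the components, so restriction commutes with it by
definition. This is why equivariance is checked for restriction and then transferred to its inverse.
-/
theorem GrV.restrictCorner_shift (h : HasGradedLocalUnits 𝒜) (δ : ℕ → Γ) (γ : Γ)
    (x : GrV (MatInf.grading 𝒜 δ)) :
    restrictCorner h δ (shift γ x) = shift γ (restrictCorner h δ x) := by
  obtain ⟨Q⟩ := x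
  rfl

variable [IsRingGrading 𝒜]

theorem GrV.restrictCorner_mk_extend (h : HasGradedLocalUnits 𝒜) (δ : ℕ → Γ)
    (P : GradedProj 𝒜) : restrictCorner h δ
      (mk (P.extend (MatInf.corner A) (MatInf.corner_mem 𝒜 δ))) = mk P :=
  mk_eq_mk.2 (P.restrictCorner_extend_iso h).symm

/-- If P ι(A) ≅ Q ι(A), then extending back to M recovers P ≅ Q; and P itself is the restriction of
P ⊗_A M. -/
theorem GrV.restrictCorner_bijective (h : HasGradedLocalUnits 𝒜) (δ : ℕ → Γ) :
    Function.Bijective (restrictCorner h δ) := by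
  constructor
  · rintro ⟨P⟩ ⟨Q⟩ hPQ
    exact mk_eq_mk.2 (((P.extend_restrictCorner_iso h).symm.trans
      ((mk_eq_mk.1 hPQ).extend _ (MatInf.corner_mem 𝒜 δ))).trans (Q.extend_restrictCorner_iso h))
  · rintro ⟨P⟩
    exact ⟨_, restrictCorner_mk_extend h δ P⟩

/-- The isomorphism `𝒱^gr(A) ≃ 𝒱^gr(M_∞(A)(δ))`, `[P] ↦ [P ⊗_A M_∞(A)(δ)]`. -/
noncomputable def GrV.cornerEquiv (h : HasGradedLocalUnits 𝒜) (δ : ℕ → Γ) :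
    GrV 𝒜 ≃+ GrV (MatInf.grading 𝒜 δ) :=
  (AddEquiv.ofBijective (restrictCorner h δ) (restrictCorner_bijective h δ)).symm

theorem GrV.cornerEquiv_mk (h : HasGradedLocalUnits 𝒜) (δ : ℕ → Γ) (P : GradedProj 𝒜) :
    cornerEquiv h δ (mk P) = mk (P.extend (MatInf.corner A) (MatInf.corner_mem 𝒜 δ)) :=
  (AddEquiv.symm_apply_eq _).2 (restrictCorner_mk_extend h δ P).symm

theorem GrV.cornerEquiv_shift (h : HasGradedLocalUnits 𝒜) (δ : ℕ → Γ) (γ : Γ) (x : GrV 𝒜) :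
    cornerEquiv h δ (shift γ x) = shift γ (cornerEquiv h δ x) := by
  obtain ⟨y, rfl⟩ := (cornerEquiv h δ).symm.surjective x
  have hy : shift γ ((cornerEquiv h δ).symm y) = (cornerEquiv h δ).symm (shift γ y) :=
    (restrictCorner_shift h δ γ y).symm
  rw [hy, AddEquiv.apply_symm_apply, AddEquiv.apply_symm_apply]

/-- The common form of both parts of the theorem: local units of degree 0 are all that is required
of `A`. -/
theorem exists_grK0_corner_equiv (h : HasGradedLocalUnits 𝒜) (δ : ℕ → Γ) :
    ∃ φ : GrK0 𝒜 ≃ₗ[AddMonoidAlgebra ℤ Γ] GrK0 (MatInf.grading 𝒜 δ),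
      (∀ x y, φ x ≤ φ y ↔ x ≤ y) ∧ ∀ P : GradedProj 𝒜, φ (GrK0.mk P) =
        GrK0.mk (P.extend (MatInf.corner A) (MatInf.corner_mem 𝒜 δ)) :=
  ⟨GrK0.congr (GrV.cornerEquiv h δ) (GrV.cornerEquiv_shift h δ),
    GrK0.congr_le_congr_iff _ _, fun P => by
      rw [GrK0.mk, GrK0.congr_of, GrV.cornerEquiv_mk]; rfl⟩

end Main

/-! ### Local units of Leavitt path algebras -/

section Leavitt

variable (K : Type w) [Field K] (G : DirectedGraph.{u, v})

open LeavittGen in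
theorem leavittGen_vertex_mul_vertex_same (v : G.V) :
    leavittGen K (vertex v : LeavittGen G) * leavittGen K (vertex v) = leavittGen K (vertex v) := by
  simpa [leavittGen] using RingQuot.mkAlgHom_rel K (LeavittRel.vertex_same (K := K) v)

open LeavittGen in
theorem leavittGen_vertex_mul_vertex_ne {v w : G.V} (h : v ≠ w) :
    leavittGen K (vertex v : LeavittGen G) * leavittGen K (vertex w) = 0 := by
  simpa [leavittGen] using RingQuot.mkAlgHom_rel K (LeavittRel.vertex_ne (K := K) v w h)

/-- Each generator lies in `v L_K(E) w` for some vertices `v` and `w`. -/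
theorem exists_vertex_mul_leavittGen (x : LeavittGen G) : ∃ v w : G.V,
    leavittGen K (.vertex v) * leavittGen K x = leavittGen K x ∧
      leavittGen K x * leavittGen K (.vertex w) = leavittGen K x := by
  cases x with
  | vertex v =>
    exact ⟨v, v, leavittGen_vertex_mul_vertex_same K G v,
      leavittGen_vertex_mul_vertex_same K G v⟩
  | edge e =>
    refine ⟨G.s e, G.r e, ?_, ?_⟩
    · simpa [leavittGen] using RingQuot.mkAlgHom_rel K (LeavittRel.source_edge (K := K) e)
    · simpa [leavittGen] using RingQuot.mkAlgHom_rel K (LeavittRel.edge_range (K := K) e)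
  | ghost e =>
    refine ⟨G.r e, G.s e, ?_, ?_⟩
    · simpa [leavittGen] using RingQuot.mkAlgHom_rel K (LeavittRel.range_ghost (K := K) e)
    · simpa [leavittGen] using RingQuot.mkAlgHom_rel K (LeavittRel.ghost_source (K := K) e)

/-- Finite sums of vertices are units for the elements of `L_K(E)`. -/
theorem exists_sum_vertex_mul_eq {x : LeavittUnital K G} (hx : x ∈ leavittSubalgebra K G) :
    -- The property for all larger T lets sums and products pass to the union of the two finite
    -- sets.
    ∃ S : Finset G.V, ∀ T, S ⊆ T →
      (∑ v ∈ T, leavittGen K (.vertex v)) * x = x ∧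
        x * ∑ v ∈ T, leavittGen K (.vertex v) = x := by
  classical
  induction hx using NonUnitalAlgebra.adjoin_induction with
  | mem x hx =>
    obtain ⟨x, rfl⟩ := hx
    obtain ⟨v, w, hv, hw⟩ := exists_vertex_mul_leavittGen K G x
    refine ⟨{v, w}, fun T hT => ⟨?_, ?_⟩⟩
    -- Vertices are orthogonal idempotents, so multiplying the sum by v leaves only v.
    · rw [← hv, ← mul_assoc, Finset.sum_mul, Finset.sum_eq_single_of_mem v (hT (by simp)),
        leavittGen_vertex_mul_vertex_same]
      intro u _ hu
      exact leavittGen_vertex_mul_vertex_ne K G hu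
    · rw [← hw, mul_assoc, Finset.mul_sum, Finset.sum_eq_single_of_mem w (hT (by simp)),
        leavittGen_vertex_mul_vertex_same]
      intro u _ hu
      exact leavittGen_vertex_mul_vertex_ne K G hu.symm
  | zero => exact ⟨∅, fun T _ => ⟨mul_zero _, zero_mul _⟩⟩
  | add x y _ _ hx hy =>
    obtain ⟨S, hS⟩ := hx
    obtain ⟨S', hS'⟩ := hy
    refine ⟨S ∪ S', fun T hT => ?_⟩
    obtain ⟨h1, h2⟩ := hS T (Finset.union_subset_left hT)
    obtain ⟨h3, h4⟩ := hS' T (Finset.union_subset_right hT)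
    rw [mul_add, add_mul, h1, h2, h3, h4]
    exact ⟨rfl, rfl⟩
  | smul c x _ hx =>
    obtain ⟨S, hS⟩ := hx
    refine ⟨S, fun T hT => ?_⟩
    rw [mul_smul_comm, smul_mul_assoc, (hS T hT).1, (hS T hT).2]
    exact ⟨rfl, rfl⟩
  | mul x y _ _ hx hy =>
    obtain ⟨S, hS⟩ := hx
    obtain ⟨S', hS'⟩ := hy
    refine ⟨S ∪ S', fun T hT => ?_⟩
    obtain ⟨h1, -⟩ := hS T (Finset.union_subset_left hT)
    obtain ⟨-, h4⟩ := hS' T (Finset.union_subset_right hT)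
    rw [← mul_assoc, h1, mul_assoc, h4]
    exact ⟨rfl, rfl⟩

theorem hasGradedLocalUnits_leavittGrading : HasGradedLocalUnits (leavittGrading K G) := by
  refine HasGradedLocalUnits.of_single fun x => ?_
  obtain ⟨S, hS⟩ := exists_sum_vertex_mul_eq K G x.2
  obtain ⟨h1, h2⟩ := hS S subset_rfl
  have hmem : ∑ v ∈ S, leavittGen K (.vertex v : LeavittGen G) ∈ leavittSubalgebra K G :=
    sum_mem fun v _ => (IsWord.gen (.vertex v)).mem
  refine ⟨⟨_, hmem⟩, ?_, Subtype.ext h1, Subtype.ext h2⟩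
  change ∑ v ∈ S, leavittGen K (.vertex v : LeavittGen G) ∈ Submodule.span K _
  exact sum_mem fun v _ => Submodule.subset_span (IsWord.gen (.vertex v))

end Leavitt

end GradedKTheory

theorem mainTheorem9 :
    (∀ {Γ : Type v} [AddCommGroup Γ] {A : Type u} [NonUnitalRing A]
      (𝒜 : Γ → AddSubgroup A) [GradedKTheory.IsRingGrading 𝒜]
      (e : ℕ → A), (∀ n, e n ∈ 𝒜 0) → (∀ n, IsIdempotentElem (e n)) →
      (∀ n, e n * e (n + 1) = e n) → (∀ a : A, ∃ n, ∃ b : A, a = e n * b * e n) →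
      ∀ δ : ℕ → Γ,
        ∃ φ : GradedKTheory.GrK0 𝒜 ≃ₗ[AddMonoidAlgebra ℤ Γ]
            GradedKTheory.GrK0 (GradedKTheory.MatInf.grading 𝒜 δ),
          (∀ x y, φ x ≤ φ y ↔ x ≤ y) ∧
          ∀ P : GradedKTheory.GradedProj 𝒜,
            φ (GradedKTheory.GrK0.mk P) = GradedKTheory.GrK0.mk
              (P.extend (GradedKTheory.MatInf.corner A)
                (GradedKTheory.MatInf.corner_mem 𝒜 δ))) ∧
    (∀ (K : Type w) [Field K] (G : GradedKTheory.DirectedGraph.{u, v})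
      [Countable G.V] [Countable G.E] (δ : ℕ → ℤ),
        ∃ φ : GradedKTheory.GrK0 (GradedKTheory.leavittGrading K G) ≃ₗ[LaurentPolynomial ℤ]
            GradedKTheory.GrK0
              (GradedKTheory.MatInf.grading (GradedKTheory.leavittGrading K G) δ),
          (∀ x y, φ x ≤ φ y ↔ x ≤ y) ∧
          ∀ P : GradedKTheory.GradedProj (GradedKTheory.leavittGrading K G),
            φ (GradedKTheory.GrK0.mk P) = GradedKTheory.GrK0.mk
              (P.extend (GradedKTheory.MatInf.corner (GradedKTheory.LeavittPathAlgebra K G))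
                (GradedKTheory.MatInf.corner_mem (GradedKTheory.leavittGrading K G) δ))) := by
  refine ⟨fun {Γ} _ {A} _ 𝒜 _ e he0 he _ hA δ => ?_, fun K _ G _ _ δ => ?_⟩
  · refine GradedKTheory.exists_grK0_corner_equiv
      (GradedKTheory.HasGradedLocalUnits.of_single fun a => ?_) δ
    -- As e_n is idempotent of degree 0, it is a two-sided unit for e_n b e_n.
    obtain ⟨n, b, rfl⟩ := hA a
    refine ⟨e n, he0 n, ?_, ?_⟩
    · rw [← mul_assoc, ← mul_assoc, (he n).eq]
    · rw [mul_assoc, (he n).eq]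
  -- `LaurentPolynomial ℤ` is the group ring ℤ[Γ] for Γ = ℤ, so the general statement applies as it
  -- stands.
  · exact GradedKTheory.exists_grK0_corner_equiv
      (GradedKTheory.hasGradedLocalUnits_leavittGrading K G) δ
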